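/- Let $-\infty\le\alpha<\beta\le\infty$ and let $U=\{s=\sigma+it\in\mathbb{C}:\alpha<\sigma<\beta\}$. Let $f$ be an almost periodic function in $U$: $f$ is analytic in $U$ and, for all real $\alpha_1\le\beta_1$ with $\alpha<\alpha_1\le\beta_1<\beta$ and every $\varepsilon>0$, there is $l>0$ such that every open interval of length $l$ contains a number $\tau$ with $|f(s+i\tau)-f(s)|\le\varepsilon$ for all $s$ with $\alpha_1\le\operatorname{Re}s\le\beta_1$. Let $\sum_{n}a_ne^{\lambda_ns}$ be the (finite or infinite) Dirichlet series of $f$. That is, the $\lambda_n$ are the distinct real numbers $\lambda$ for which the mean value $$\lim_{T\to\infty}\frac1{2T}\int_{-T}^{T}f(c+it)\,e^{-\lambda(c+it)}\,dt ,$$ which exists and is independent of $c\in(\alpha,\beta)$, is nonzero, and $a_n$ is this mean value for $\lambda=\lambda_n$. Suppose that there are at least three exponents $\lambda_n$ and that they are linearly independent over $\mathbb{Q}$. Put $$R_f=\overline{\{\operatorname{Re}s:f(s)=0,\ s\in U\}}\cap(\alpha,\beta),$$ and let $\sigma_0\in(\alpha,\beta)$. Then $\sum_i|a_i|e^{\sigma_0\lambda_i}<\infty$,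 and $\sigma_0\in R_f$ if and only if $$|a_j|e^{\sigma_0\lambda_j}\le\sum_{i\ne j}|a_i|e^{\sigma_0\lambda_i}\qquad\text{for every } j .$$ -/

import Mathlib

open Filter Topology

namespace AlmostPeriodicStrip

/-- The open vertical strip `α < Re s < β`, where `α = -∞` and `β = ∞` are allowed. -/
def strip (α β : EReal) : Set ℂ :=
  {s : ℂ | α < (s.re : EReal) ∧ (s.re : EReal) < β}

/-- `f` is an (analytic) almost periodic function in the strip `α < Re s < β`: it is analytic there
and, on every reduced strip `α₁ ≤ Re s ≤ β₁` with `α < α₁ ≤ β₁ < β`, for every `ε > 0` there is a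
length `l` such that every open interval of length `l` contains a translation number `τ` with
`|f (s + iτ) - f s| ≤ ε` on the whole reduced strip. -/
def IsAlmostPeriodic (α β : EReal) (f : ℂ → ℂ) : Prop :=
  DifferentiableOn ℂ f (strip α β) ∧
    ∀ α₁ β₁ : ℝ, α < (α₁ : EReal) → α₁ ≤ β₁ → (β₁ : EReal) < β →
      ∀ ε : ℝ, 0 < ε → ∃ l : ℝ, 0 < l ∧ ∀ t₀ : ℝ, ∃ τ ∈ Set.Ioo t₀ (t₀ + l),
        ∀ s : ℂ, α₁ ≤ s.re → s.re ≤ β₁ → ‖f (s + τ * Complex.I) - f s‖ ≤ ε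

/-- The Fourier coefficient of `f` at the exponent `μ`, computed on the line `Re s = c`, is `a`:
`a` is the mean value `lim_{T → ∞} (1 / 2T) ∫_{-T}^{T} f (c + it) e^{-μ (c + it)} dt`. -/
def HasFourierCoeff (f : ℂ → ℂ) (c μ : ℝ) (a : ℂ) : Prop :=
  Tendsto (fun T : ℝ => (2 * (T : ℂ))⁻¹ *
      ∫ t in (-T)..T, f (c + t * Complex.I) * Complex.exp (-(μ : ℂ) * (c + t * Complex.I)))
    atTop (𝓝 a)

/-- `∑ₙ aₙ e^{νₙ s}` is the Dirichlet series of `f` in the strip `α < Re s < β`: the `νₙ` are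
distinct, the `aₙ` are nonzero, the Fourier coefficient of `f` at `νₙ` is `aₙ`, and the one at
every other real number is `0`. For an almost periodic function the mean values exist on every
vertical line of the strip and do not depend on the line, so that it suffices to ask for one line;
their existence on the other lines and the independence are not part of the definition. -/
def IsDirichletSeries {ι : Type*} (α β : EReal) (f : ℂ → ℂ) (a : ι → ℂ) (ν : ι → ℝ) : Prop :=
  Function.Injective ν ∧ (∀ n, a n ≠ 0) ∧
    ∃ c : ℝ, α < (c : EReal) ∧ (c : EReal) < β ∧
      (∀ n, HasFourierCoeff f c (ν n) (a n)) ∧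
      ∀ μ : ℝ, μ ∉ Set.range ν → HasFourierCoeff f c μ 0

/-- The set `R_f`: the closure of the set of real parts of the zeros of `f` in the strip
`α < Re s < β`, intersected with the interval `(α, β)`. -/
def zeroProjections (α β : EReal) (f : ℂ → ℂ) : Set ℝ :=
  closure (Complex.re '' {s : ℂ | s ∈ strip α β ∧ f s = 0}) ∩
    {σ : ℝ | α < (σ : EReal) ∧ (σ : EReal) < β}

end AlmostPeriodicStrip

/-! On each vertical line of the strip `f` is a Bohr almost periodic function with linearly
independent exponents. Such a function is the sum of its absolutely convergent Fourier series, so on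
the strip `f(s) = ∑ aᵢ e^{νᵢ s}` absolutely (`IsAlmostPeriodic.hasSum_dirichletSeries`). This rests
on two classical facts. Testing against a Riesz product, a nonnegative kernel of mean 1, bounds
every finite sum of moduli of coefficients by `2 sup |F|` (`sum_norm_le_of_linearIndependent`). The
uniqueness theorem `HasCompactHull.eq_zero` then identifies the function with the sum of its series.

Necessity of the inequalities: if the `j`-th term strictly exceeds the sum of the other moduli at
`σ₀`, it does so by continuity on all nearby lines. At a zero, however, that term is minus the sum
of the others, so no zero has real part near `σ₀`.

Sufficiency: lengths none of which exceeds the sum of the others are the sides of a closed, possibly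
infinite, polygon (`exists_circle_tsum_eq_zero`). Hence phases `θᵢ` exist for which the rephased
series `G(s) = ∑ aᵢ θᵢ e^{νᵢ s}` vanishes at `σ₀`. By Kronecker's theorem some vertical translate of
`f` is uniformly close to `G` near `σ₀`. Since `G` is not identically zero, its zero at `σ₀` is
isolated, and a minimum-modulus argument gives the translate of `f` a zero nearby
(`mem_zeroProjections_of_phases`). -/

namespace AlmostPeriodicStrip

open Filter Topology MeasureTheory AddCircle ComplexConjugate
open scoped BoundedContinuousFunction

/-! ### Bohr almost periodic functions and compactness of their translates -/

/-- Almost periodicity in the sense of Bohr for functions on the real line. -/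
def IsBohr (g : ℝ → ℂ) : Prop :=
  Continuous g ∧ ∀ ε : ℝ, 0 < ε → ∃ l : ℝ, 0 < l ∧ ∀ t₀ : ℝ, ∃ τ ∈ Set.Ioo t₀ (t₀ + l),
    ∀ x : ℝ, ‖g (x + τ) - g x‖ ≤ ε

/-- The translates of `g` lie in a compact set of bounded continuous functions. -/
def HasCompactHull (g : ℝ → ℂ) : Prop :=
  ∃ K : Set (ℝ →ᵇ ℂ), IsCompact K ∧ ∀ t : ℝ, ∃ b ∈ K, ∀ x, b x = g (x + t)

theorem IsBohr.exists_bound {g : ℝ → ℂ} (hg : IsBohr g) : ∃ C : ℝ, 0 < C ∧ ∀ x, ‖g x‖ ≤ C := by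
  obtain ⟨l, hl, h⟩ := hg.2 1 one_pos
  obtain ⟨C, hC⟩ := (isCompact_Icc (a := (0 : ℝ)) (b := l)).exists_bound_of_continuousOn
    hg.1.continuousOn
  refine ⟨|C| + 1, by positivity, fun x => ?_⟩
  obtain ⟨τ, hτ, hx⟩ := h (-x)
  have h1 := hC (x + τ) ⟨by linarith [hτ.1], by linarith [hτ.2]⟩
  have h2 := hx x
  have h3 := norm_sub_norm_le (g x) (g (x + τ))
  rw [norm_sub_rev] at h3
  linarith [le_abs_self C]

/-- One translation number carries both points into the compact interval `[-1, l + 1]`, where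
uniform continuity is available. -/
theorem IsBohr.exists_modulus {g : ℝ → ℂ} (hg : IsBohr g) {ε : ℝ} (hε : 0 < ε) :
    ∃ δ : ℝ, 0 < δ ∧ ∀ x y, |x - y| < δ → ‖g x - g y‖ ≤ ε := by
  obtain ⟨l, hl, h⟩ := hg.2 (ε / 3) (by positivity)
  have hu := (isCompact_Icc (a := (-1 : ℝ)) (b := l + 1)).uniformContinuousOn_of_continuous
    hg.1.continuousOn
  obtain ⟨δ, hδ, hu⟩ := Metric.uniformContinuousOn_iff.1 hu (ε / 3) (by positivity)
  refine ⟨min δ 1, by positivity, fun x y hxy => ?_⟩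
  obtain ⟨τ, hτ, hx⟩ := h (-x)
  have hxy1 : |x - y| < 1 := hxy.trans_le (min_le_right _ _)
  rw [abs_lt] at hxy1
  have h1 := hu (x + τ) ⟨by linarith [hτ.1], by linarith [hτ.2]⟩ (y + τ)
    ⟨by linarith [hτ.1], by linarith [hτ.2]⟩ (by
      rw [Real.dist_eq]; simpa using hxy.trans_le (min_le_left _ _))
  rw [dist_eq_norm] at h1
  have e : g x - g y = -(g (x + τ) - g x) + (g (x + τ) - g (y + τ)) + (g (y + τ) - g y) := by ring
  rw [e]
  refine (norm_add₃_le).trans ?_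
  rw [norm_neg]
  linarith [hx x, hx y]

theorem HasCompactHull.continuous {g : ℝ → ℂ} (hg : HasCompactHull g) : Continuous g := by
  obtain ⟨K, -, h⟩ := hg
  obtain ⟨b, -, hb⟩ := h 0
  have : g = b := by ext x; simp [hb x]
  rw [this]; exact b.continuous

/-- Translates by the finitely many `φ b` form an `ε`-net of all translates. If the translates by
`t` and by `φ b` are `ε`-close, then `t - φ b` is a translation number, and boundedness of `φ` keeps
it near `t`. -/
theorem HasCompactHull.isBohr {g : ℝ → ℂ} (hg : HasCompactHull g) : IsBohr g := by
  refine ⟨hg.continuous, fun ε hε => ?_⟩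
  obtain ⟨K, hK, h⟩ := hg
  have htb : TotallyBounded {b : ℝ →ᵇ ℂ | ∃ t : ℝ, ∀ x, b x = g (x + t)} := by
    refine hK.totallyBounded.subset ?_
    rintro b ⟨t, ht⟩
    obtain ⟨b', hb', h'⟩ := h t
    have : b = b' := by ext x; rw [ht, h']
    exact this ▸ hb'
  obtain ⟨s, hs, hfin, hcov⟩ := totallyBounded_iff_subset.1 htb _ (Metric.dist_mem_uniformity hε)
  have hs' : ∀ b ∈ s, ∃ t : ℝ, ∀ x, b x = g (x + t) := fun b hb => hs hb
  choose! φ hφ using hs'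
  obtain ⟨M, hM⟩ := (hfin.image (fun b => |φ b|)).bddAbove
  refine ⟨2 * |M| + 1, by positivity, fun t₀ => ?_⟩
  obtain ⟨b, hbK, hb⟩ := h (t₀ + |M| + 1 / 2)
  have hb' := hcov (show b ∈ _ from ⟨_, hb⟩)
  simp only [Set.mem_iUnion, Set.mem_ofPred_eq] at hb'
  obtain ⟨b₁, hb₁, hd⟩ := hb'
  have h1 : |φ b₁| ≤ M := hM ⟨b₁, hb₁, rfl⟩
  have h2 := abs_le.1 (h1.trans (le_abs_self M))
  refine ⟨t₀ + |M| + 1 / 2 - φ b₁, ⟨by linarith [h2.2], by linarith [h2.1]⟩, fun x => ?_⟩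
  have h3 := (BoundedContinuousFunction.dist_coe_le_dist (f := b) (g := b₁) (x - φ b₁)).trans hd.le
  rw [hb, hφ b₁ hb₁, dist_eq_norm] at h3
  rwa [sub_add_cancel, sub_add_eq_add_sub, add_sub_assoc] at h3

/-- Up to a translation number, every translate is one by an amount in `[0, l]`; uniform continuity
reduces these to finitely many. -/
theorem IsBohr.hasCompactHull {g : ℝ → ℂ} (hg : IsBohr g) : HasCompactHull g := by
  obtain ⟨C, hC, hbd⟩ := hg.exists_bound
  let tr : ℝ → (ℝ →ᵇ ℂ) := fun t =>
    BoundedContinuousFunction.ofNormedAddCommGroup (fun x => g (x + t))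
      (hg.1.comp (continuous_add_const t)) C (fun x => hbd _)
  have htr : ∀ t x, tr t x = g (x + t) := fun t x => rfl
  refine ⟨closure (Set.range tr), ?_, fun t => ⟨tr t, subset_closure ⟨t, rfl⟩, htr t⟩⟩
  refine (TotallyBounded.closure ?_).isCompact_of_isClosed isClosed_closure
  refine Metric.totallyBounded_iff.2 fun ε hε => ?_
  obtain ⟨l, hl, h⟩ := hg.2 (ε / 3) (by positivity)
  obtain ⟨δ, hδ, hm⟩ := hg.exists_modulus (show 0 < ε / 3 by positivity)
  obtain ⟨s, -, hfin, hs⟩ := (isCompact_Icc (a := (0 : ℝ)) (b := l)).finite_cover_balls hδ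
  refine ⟨tr '' s, hfin.image _, ?_⟩
  rintro _ ⟨t, rfl⟩
  obtain ⟨τ, hτ, hx⟩ := h (-t)
  have hmem := hs (show t + τ ∈ Set.Icc 0 l from ⟨by linarith [hτ.1], by linarith [hτ.2]⟩)
  simp only [Set.mem_iUnion, Metric.mem_ball, Real.dist_eq] at hmem
  obtain ⟨r, hr, hd⟩ := hmem
  refine Set.mem_iUnion₂.2 ⟨tr r, ⟨r, hr, rfl⟩, ?_⟩
  rw [Metric.mem_ball]
  refine lt_of_le_of_lt ((BoundedContinuousFunction.dist_le (C := 2 * ε / 3) (by positivity)).2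
    fun x => ?_) (by linarith)
  rw [htr, htr, dist_eq_norm]
  have h1 := hx (x + t)
  have h2 := hm (x + t + τ) (x + r) (by convert hd using 2; ring)
  rw [norm_sub_rev] at h1
  calc _ = ‖(g (x + t) - g (x + t + τ)) + (g (x + t + τ) - g (x + r))‖ := by ring_nf
    _ ≤ _ := (norm_add_le _ _).trans (by linarith)

/-- This is the gain of the compactness formulation: sums and products inherit it from a continuous
image of `K ×ˢ L`, with no need to look for common translation numbers. -/
theorem HasCompactHull.add {f g : ℝ → ℂ} (hf : HasCompactHull f) (hg : HasCompactHull g) :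
    HasCompactHull (fun x => f x + g x) := by
  obtain ⟨K, hK, h⟩ := hf
  obtain ⟨L, hL, h'⟩ := hg
  refine ⟨(fun p : (ℝ →ᵇ ℂ) × (ℝ →ᵇ ℂ) => p.1 + p.2) '' (K ×ˢ L),
    (hK.prod hL).image (by fun_prop), fun t => ?_⟩
  obtain ⟨b, hb, hx⟩ := h t
  obtain ⟨b', hb', hx'⟩ := h' t
  exact ⟨b + b', ⟨(b, b'), ⟨hb, hb'⟩, rfl⟩, fun x => by simp [hx, hx']⟩

theorem HasCompactHull.mul {f g : ℝ → ℂ} (hf : HasCompactHull f) (hg : HasCompactHull g) :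
    HasCompactHull (fun x => f x * g x) := by
  obtain ⟨K, hK, h⟩ := hf
  obtain ⟨L, hL, h'⟩ := hg
  refine ⟨(fun p : (ℝ →ᵇ ℂ) × (ℝ →ᵇ ℂ) => p.1 * p.2) '' (K ×ˢ L),
    (hK.prod hL).image (by fun_prop), fun t => ?_⟩
  obtain ⟨b, hb, hx⟩ := h t
  obtain ⟨b', hb', hx'⟩ := h' t
  exact ⟨b * b', ⟨(b, b'), ⟨hb, hb'⟩, rfl⟩, fun x => by simp [hx, hx']⟩

theorem norm_exp_ofReal_mul_I' (u v : ℝ) : ‖Complex.exp (u * v * Complex.I)‖ = 1 := by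
  rw [← Complex.ofReal_mul, Complex.norm_exp_ofReal_mul_I]

/-- An absolutely convergent sum of exponentials has relatively compact translates. -/
theorem hasCompactHull_tsum {ι : Type*} {A : ι → ℂ} (hA : Summable fun i => ‖A i‖) (ν : ι → ℝ) :
    HasCompactHull (fun x : ℝ => ∑' i, A i * Complex.exp (ν i * x * Complex.I)) := by
  let e : ι → (ℝ →ᵇ ℂ) := fun i =>
    BoundedContinuousFunction.ofNormedAddCommGroup
      (fun x : ℝ => Complex.exp (ν i * x * Complex.I)) (by fun_prop) 1
      (fun x => (norm_exp_ofReal_mul_I' _ _).le)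
  have he : ∀ i x, e i x = Complex.exp (ν i * x * Complex.I) := fun i x => rfl
  have hen : ∀ i, ‖e i‖ ≤ 1 := fun i => (BoundedContinuousFunction.norm_le zero_le_one).2
    fun x => (norm_exp_ofReal_mul_I' _ _).le
  have hle : ∀ i (θ : ι → Circle), ‖(A i * (θ i : ℂ)) • e i‖ ≤ ‖A i‖ := fun i θ => by
    rw [norm_smul, norm_mul, Circle.norm_coe, mul_one]
    exact mul_le_of_le_one_right (norm_nonneg _) (hen i)
  -- A translation only changes the phases of the terms, so all translates lie in the continuous
  -- image of the torus `ι → Circle`, compact by Tychonoff.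
  refine ⟨Set.range fun θ : ι → Circle => ∑' i, (A i * (θ i : ℂ)) • e i, isCompact_range ?_,
    fun t => ⟨_, ⟨fun i => Circle.exp (ν i * t), rfl⟩, fun x => ?_⟩⟩
  · exact continuous_tsum (fun i => by fun_prop) hA hle
  · have hs : Summable fun i => (A i * (Circle.exp (ν i * t) : ℂ)) • e i :=
      Summable.of_norm_bounded hA fun i => hle i fun i => Circle.exp (ν i * t)
    have := (BoundedContinuousFunction.evalCLM ℂ x).map_tsum hs
    simp only [BoundedContinuousFunction.evalCLM_apply] at this
    rw [this]
    refine tsum_congr fun i => ?_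
    rw [BoundedContinuousFunction.smul_apply, he, smul_eq_mul, Circle.coe_exp, mul_assoc,
      ← Complex.exp_add]
    push_cast
    ring_nf

theorem hasCompactHull_exp (μ : ℝ) :
    HasCompactHull (fun x : ℝ => Complex.exp (μ * x * Complex.I)) := by
  simpa using hasCompactHull_tsum (ι := Unit) (A := fun _ => 1) .of_finite (fun _ => μ)

/-! ### Mean values and uniformly small Fourier integrals -/

/-- `g` has mean value `m`, over the symmetric intervals `[-T, T]`. -/
def HasMean (g : ℝ → ℂ) (m : ℂ) : Prop :=
  Tendsto (fun T : ℝ => (2 * (T : ℂ))⁻¹ * ∫ t in (-T)..T, g t) atTop (𝓝 m)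

theorem norm_integral_le_of_le {g : ℝ → ℂ} {C : ℝ} (hC : ∀ x, ‖g x‖ ≤ C) {a b : ℝ} (hab : a ≤ b) :
    ‖∫ x in a..b, g x‖ ≤ C * (b - a) := by
  have := intervalIntegral.norm_integral_le_of_norm_le_const (a := a) (b := b) (f := g) (C := C)
    fun x _ => hC x
  rwa [abs_of_nonneg (by linarith)] at this

/-- Integrals over two windows of the same length that start at nearby points are close. -/
theorem norm_integral_sub_integral_le {g : ℝ → ℂ} (hg : Continuous g) {C : ℝ}
    (hC : ∀ x, ‖g x‖ ≤ C) {a b L δ : ℝ} (hab : |a - b| ≤ δ) :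
    ‖(∫ x in a..(a + L), g x) - ∫ x in b..(b + L), g x‖ ≤ 2 * C * δ := by
  have hi : ∀ u v : ℝ, IntervalIntegrable g volume u v := fun u v => hg.intervalIntegrable u v
  have e : (∫ x in a..(a + L), g x) - ∫ x in b..(b + L), g x
      = (∫ x in a..b, g x) - ∫ x in (a + L)..(b + L), g x := by
    have h1 := intervalIntegral.integral_add_adjacent_intervals (hi a b) (hi b (b + L))
    have h2 := intervalIntegral.integral_add_adjacent_intervals (hi a (a + L)) (hi (a + L) (b + L))
    linear_combination h2 - h1
  have hC0 : 0 ≤ C := (norm_nonneg _).trans (hC 0)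
  rw [e]
  refine (norm_sub_le _ _).trans ?_
  have h1 := intervalIntegral.norm_integral_le_of_norm_le_const (a := a) (b := b) (f := g) (C := C)
    fun x _ => hC x
  have h2 := intervalIntegral.norm_integral_le_of_norm_le_const (a := a + L) (b := b + L)
    (f := g) (C := C) fun x _ => hC x
  rw [add_sub_add_right_eq_sub] at h2
  rw [abs_sub_comm] at hab
  nlinarith [mul_le_mul_of_nonneg_left hab hC0]

/-- A Bohr almost periodic function of mean zero has small means over all long windows. -/
theorem IsBohr.exists_window {h : ℝ → ℂ} (hh : IsBohr h) (hm : HasMean h 0) {ε : ℝ} (hε : 0 < ε) :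
    ∃ ℓ : ℝ, 0 < ℓ ∧ ∀ a : ℝ, ‖∫ x in a..(a + ℓ), h x‖ ≤ ε * ℓ := by
  obtain ⟨C, hC0, hC⟩ := hh.exists_bound
  obtain ⟨l, hl, hτ⟩ := hh.2 (ε / 3) (by positivity)
  have hev := (Metric.tendsto_nhds.1 hm) (ε / 3) (by positivity)
  obtain ⟨T, hT1, hT2, hT3⟩ :=
    (hev.and ((eventually_gt_atTop 0).and (eventually_ge_atTop (3 * C * l / ε)))).exists
  refine ⟨2 * T, by positivity, fun a => ?_⟩
  -- The window `[τ - T, τ + T]` starts within `l` of `a`. The error `2 * C * l` of replacing one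
  -- window by the other is absorbed by the lower bound `3 * C * l / ε` on `T`.
  obtain ⟨τ, hτm, hx⟩ := hτ (a + T - l)
  have hi : ∀ u v : ℝ, IntervalIntegrable h volume u v := fun u v => hh.1.intervalIntegrable u v
  have h1 : ‖(∫ x in a..(a + 2 * T), h x) - ∫ x in (τ - T)..(τ - T + 2 * T), h x‖ ≤ 2 * C * l :=
    norm_integral_sub_integral_le hh.1 hC
      (abs_le.2 ⟨by linarith [hτm.2], by linarith [hτm.1]⟩)
  have h2 : ∫ x in (τ - T)..(τ - T + 2 * T), h x = ∫ x in (-T)..T, h (x + τ) := by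
    rw [intervalIntegral.integral_comp_add_right]
    congr 1 <;> ring
  have h3 : ‖(∫ x in (-T)..T, h (x + τ)) - ∫ x in (-T)..T, h x‖ ≤ ε / 3 * (2 * T) := by
    have hc : Continuous fun x => h (x + τ) := hh.1.comp (continuous_add_const τ)
    rw [← intervalIntegral.integral_sub (hc.intervalIntegrable _ _) (hi _ _)]
    refine (norm_integral_le_of_le hx (by linarith)).trans (by linarith)
  have h4 : ‖∫ x in (-T)..T, h x‖ ≤ ε / 3 * (2 * T) := by
    rw [dist_zero_right, norm_mul, norm_inv] at hT1
    have : ‖(2 * (T : ℂ))‖ = 2 * T := by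
      rw [norm_mul, Complex.norm_real, Real.norm_of_nonneg hT2.le]; simp
    rw [this, inv_mul_lt_iff₀ (by positivity)] at hT1
    linarith
  have h5 : 2 * C * l ≤ ε / 3 * (2 * T) := by
    rw [div_le_iff₀ hε] at hT3
    linarith
  have e : (∫ x in a..(a + 2 * T), h x) =
      ((∫ x in a..(a + 2 * T), h x) - ∫ x in (τ - T)..(τ - T + 2 * T), h x)
      + ((∫ x in (-T)..T, h (x + τ)) - ∫ x in (-T)..T, h x) + ∫ x in (-T)..T, h x := by
    rw [h2]; ring
  rw [e]
  refine norm_add₃_le.trans ?_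
  linarith

/-- The character `x ↦ e^{-iλx}`. -/
noncomputable def chr (lam x : ℝ) : ℂ := Complex.exp (-(lam * x) * Complex.I)

theorem norm_chr (lam x : ℝ) : ‖chr lam x‖ = 1 := by
  rw [chr, ← Complex.ofReal_mul, ← Complex.ofReal_neg, Complex.norm_exp_ofReal_mul_I]

@[fun_prop]
theorem continuous_chr (lam : ℝ) : Continuous (chr lam) := by unfold chr; fun_prop

theorem chr_add (lam x y : ℝ) : chr lam (x + y) = chr lam x * chr lam y := by
  simp only [chr]; rw [← Complex.exp_add]; push_cast; ring_nf

theorem norm_chr_sub_one_le (lam x : ℝ) : ‖chr lam x - 1‖ ≤ |lam * x| := by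
  have := Real.norm_exp_I_mul_ofReal_sub_one_le (x := -(lam * x))
  rw [Real.norm_eq_abs, abs_neg] at this
  convert this using 3
  rw [chr]; push_cast; ring_nf

theorem hasCompactHull_chr (lam : ℝ) : HasCompactHull (chr lam) := by
  have e : chr lam = fun x : ℝ => Complex.exp ((-lam : ℝ) * x * Complex.I) := by
    ext x; rw [chr]; push_cast; ring_nf
  exact e ▸ hasCompactHull_exp (-lam)

/-- Riemann–Lebesgue: for high frequencies the truncated Fourier integrals are small. -/
theorem IsBohr.exists_highFrequency {g : ℝ → ℂ} (hg : IsBohr g) {ε : ℝ} (hε : 0 < ε) :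
    ∃ M : ℝ, 0 < M ∧ ∃ T₀ : ℝ, 0 < T₀ ∧ ∀ T, T₀ ≤ T → ∀ lam : ℝ, M ≤ |lam| →
      ‖∫ x in (0 : ℝ)..T, g x * chr lam x‖ ≤ ε * T := by
  obtain ⟨C, hC0, hC⟩ := hg.exists_bound
  obtain ⟨δ, hδ, hmod⟩ := hg.exists_modulus hε
  refine ⟨2 * Real.pi / δ, by positivity, 2 * C * δ / ε, by positivity, fun T hT lam hlam => ?_⟩
  have hT0 : 0 < T := lt_of_lt_of_le (by positivity) hT
  have hlam0 : lam ≠ 0 := by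
    rintro rfl
    rw [abs_zero] at hlam
    exact absurd hlam (not_le.2 (by positivity))
  -- A shift by the half period `p` reverses the sign of the character. Twice the integral is
  -- therefore, up to boundary terms, the integral of `(g x - g (x + p)) * chr lam x`, and `|p| < δ`
  -- makes it small.
  set p : ℝ := Real.pi / lam with hp
  have hpδ : |p| < δ := by
    have hl : 0 < |lam| := abs_pos.2 hlam0
    rw [hp, abs_div, abs_of_pos Real.pi_pos, div_lt_iff₀ hl]
    rw [div_le_iff₀ hδ] at hlam
    nlinarith [Real.pi_pos]
  have hchr : ∀ x, chr lam (x + p) = - chr lam x := fun x => by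
    rw [chr_add]
    have : chr lam p = -1 := by
      rw [chr, hp, ← Complex.ofReal_mul, mul_div_cancel₀ _ hlam0, neg_mul, Complex.exp_neg,
        Complex.exp_pi_mul_I]; norm_num
    rw [this]; ring
  have hcont : Continuous fun x => g x * chr lam x := hg.1.mul (continuous_chr lam)
  have hbd : ∀ x, ‖g x * chr lam x‖ ≤ C := fun x => by rw [norm_mul, norm_chr, mul_one]; exact hC x
  have h1 := norm_integral_sub_integral_le hcont hbd (a := 0) (b := p) (L := T) (δ := δ)
    (by rw [zero_sub, abs_neg]; exact hpδ.le)
  have h2 : ∫ x in p..(p + T), g x * chr lam x = -∫ x in (0 : ℝ)..T, g (x + p) * chr lam x := by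
    rw [← intervalIntegral.integral_neg]
    have := intervalIntegral.integral_comp_add_right (a := 0) (b := T)
      (fun x => g x * chr lam x) p
    rw [zero_add, add_comm T p] at this
    rw [← this]
    refine intervalIntegral.integral_congr fun x _ => ?_
    simp only [hchr]; ring
  have h3 : ‖(∫ x in (0 : ℝ)..T, g x * chr lam x) - ∫ x in (0 : ℝ)..T, g (x + p) * chr lam x‖
      ≤ ε * T := by
    have hc : Continuous fun x => g (x + p) * chr lam x :=
      (hg.1.comp (continuous_add_const p)).mul (continuous_chr lam)
    rw [← intervalIntegral.integral_sub (hcont.intervalIntegrable _ _) (hc.intervalIntegrable _ _)]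
    refine (norm_integral_le_of_le (C := ε) (fun x => ?_) hT0.le).trans (by rw [sub_zero])
    rw [← sub_mul, norm_mul, norm_chr, mul_one]
    exact hmod _ _ (by simpa using hpδ)
  rw [h2, zero_add] at h1
  have h4 : 2 * C * δ ≤ ε * T := by rwa [div_le_iff₀' hε] at hT
  set I := ∫ x in (0 : ℝ)..T, g x * chr lam x
  set J := ∫ x in (0 : ℝ)..T, g (x + p) * chr lam x
  have h5 : ‖(2 : ℂ) * I‖ ≤ ‖I - -J‖ + ‖I - J‖ := by
    refine le_trans (le_of_eq ?_) (norm_add_le _ _); ring_nf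
  rw [norm_mul, Complex.norm_ofNat] at h5
  linarith

/-- Small integrals over all windows of one length give small integrals over long intervals. -/
theorem exists_forall_norm_integral_le {C ε ℓ : ℝ} (hε : 0 < ε) (hℓ : 0 < ℓ) :
    ∃ T₀ : ℝ, 0 < T₀ ∧ ∀ g : ℝ → ℂ, Continuous g → (∀ x, ‖g x‖ ≤ C) →
      (∀ a, ‖∫ x in a..(a + ℓ), g x‖ ≤ ε * ℓ) →
        ∀ T, T₀ ≤ T → ‖∫ x in (0 : ℝ)..T, g x‖ ≤ 2 * ε * T := by
  refine ⟨|C| * ℓ / ε + 1, by positivity, fun g hg hC hw T hT => ?_⟩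
  have hT0 : 0 < T := lt_of_lt_of_le (by positivity) hT
  have hi : ∀ u v : ℝ, IntervalIntegrable g volume u v := fun u v => hg.intervalIntegrable u v
  have hn : ∀ n : ℕ, ‖∫ x in (0 : ℝ)..(n * ℓ), g x‖ ≤ ε * (n * ℓ) := by
    intro n
    induction n with
    | zero => simp
    | succ n ih =>
      rw [← intervalIntegral.integral_add_adjacent_intervals (hi 0 (n * ℓ)) (hi _ _)]
      have := hw (n * ℓ)
      have e : ((n + 1 : ℕ) : ℝ) * ℓ = n * ℓ + ℓ := by push_cast; ring
      rw [e]
      exact (norm_add_le _ _).trans (by linarith)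
  have hfl := Nat.floor_le (show 0 ≤ T / ℓ by positivity)
  have hfl' := Nat.lt_floor_add_one (T / ℓ)
  set N := ⌊T / ℓ⌋₊
  rw [le_div_iff₀ hℓ] at hfl
  rw [div_lt_iff₀ hℓ] at hfl'
  rw [← intervalIntegral.integral_add_adjacent_intervals (hi 0 (N * ℓ)) (hi _ _)]
  have h1 := norm_integral_le_of_le (fun x => (hC x).trans (le_abs_self C)) hfl
  have h2 : |C| * (T - N * ℓ) ≤ |C| * ℓ := mul_le_mul_of_nonneg_left (by linarith) (abs_nonneg C)
  have h3 : |C| * ℓ ≤ ε * T := by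
    rw [← div_le_iff₀' hε]; linarith
  have h4 := mul_le_mul_of_nonneg_left hfl hε.le
  exact (norm_add_le _ _).trans (by linarith [hn N])

/-- If all Fourier coefficients of an almost periodic function vanish, the truncated means
`T⁻¹ ∫₀ᵀ g(x) e^{-iλx} dx` tend to zero uniformly in `λ`. -/
theorem HasCompactHull.uniform_fourier {g : ℝ → ℂ} (hg : HasCompactHull g)
    (hm : ∀ lam : ℝ, HasMean (fun x => g x * chr lam x) 0) {ε : ℝ} (hε : 0 < ε) :
    ∃ T₀ : ℝ, 0 < T₀ ∧ ∀ T, T₀ ≤ T → ∀ lam : ℝ, ‖∫ x in (0 : ℝ)..T, g x * chr lam x‖ ≤ ε * T := by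
  obtain ⟨C, hC0, hC⟩ := hg.isBohr.exists_bound
  obtain ⟨M, hM, T₁, hT₁, h1⟩ := hg.isBohr.exists_highFrequency hε
  have hcomp : ∃ T₀ : ℝ, ∀ T, T₀ ≤ T → ∀ lam ∈ Set.Icc (-M) M,
      ‖∫ x in (0 : ℝ)..T, g x * chr lam x‖ ≤ ε * T := by
    -- High frequencies are settled by Riemann–Lebesgue. On the compact range that is left, a
    -- threshold valid near each frequency suffices.
    refine (isCompact_Icc (a := -M) (b := M)).induction_on
      (p := fun s => ∃ T₀ : ℝ, ∀ T, T₀ ≤ T → ∀ lam ∈ s,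
        ‖∫ x in (0 : ℝ)..T, g x * chr lam x‖ ≤ ε * T) ⟨0, by simp⟩ ?_ ?_ ?_
    · rintro s t hst ⟨T₀, h⟩
      exact ⟨T₀, fun T hT lam hl => h T hT lam (hst hl)⟩
    · rintro s t ⟨T₀, h⟩ ⟨T₀', h'⟩
      refine ⟨max T₀ T₀', fun T hT lam hl => ?_⟩
      rcases hl with hl | hl
      · exact h T ((le_max_left _ _).trans hT) lam hl
      · exact h' T ((le_max_right _ _).trans hT) lam hl
    · intro lam₀ _
      obtain ⟨ℓ, hℓ, hw⟩ := (hg.mul (hasCompactHull_chr lam₀)).isBohr.exists_window (hm lam₀)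
        (show 0 < ε / 4 by positivity)
      obtain ⟨T₀, -, hT⟩ := exists_forall_norm_integral_le (C := C) (show 0 < ε / 2 by positivity) hℓ
      -- With this radius the characters of `lam` and `lam₀`, normalised to agree at `a`, differ by
      -- at most `ε / (4 * C)` on a window of length `ℓ`, wherever the window lies.
      refine ⟨Metric.ball lam₀ (ε / (4 * C * ℓ)),
        mem_nhdsWithin_of_mem_nhds (Metric.ball_mem_nhds _ (by positivity)), T₀,
        fun T hTT lam hl => ?_⟩
      rw [Metric.mem_ball, Real.dist_eq] at hl
      refine (hT (fun x => g x * chr lam x) (hg.continuous.mul (continuous_chr lam))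
        (fun x => by rw [norm_mul, norm_chr, mul_one]; exact hC x) (fun a => ?_) T hTT).trans
        (by linarith)
      have hsplit : ∀ x, g x * chr lam x = chr (lam - lam₀) a *
          (g x * chr lam₀ x + g x * chr lam₀ x * (chr (lam - lam₀) (x - a) - 1)) := fun x => by
        have e1 : chr (lam - lam₀) a * chr (lam - lam₀) (x - a) = chr (lam - lam₀) x := by
          rw [← chr_add]; congr 1; ring
        have e2 : chr lam x = chr lam₀ x * chr (lam - lam₀) x := by
          simp only [chr]; rw [← Complex.exp_add]; push_cast; ring_nf
        rw [e2, ← e1]; ring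
      have hc1 : Continuous fun x => g x * chr lam₀ x := hg.continuous.mul (continuous_chr _)
      have hc2 : Continuous fun x => g x * chr lam₀ x * (chr (lam - lam₀) (x - a) - 1) := by
        fun_prop
      simp_rw [hsplit]
      rw [intervalIntegral.integral_const_mul, norm_mul, norm_chr, one_mul,
        intervalIntegral.integral_add (hc1.intervalIntegrable _ _) (hc2.intervalIntegrable _ _)]
      have hb : ‖∫ x in a..(a + ℓ), g x * chr lam₀ x * (chr (lam - lam₀) (x - a) - 1)‖
          ≤ ε / 4 * ℓ := by
        have := intervalIntegral.norm_integral_le_of_norm_le_const (a := a) (b := a + ℓ)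
          (f := fun x => g x * chr lam₀ x * (chr (lam - lam₀) (x - a) - 1)) (C := ε / 4) ?_
        · rwa [add_sub_cancel_left, abs_of_pos hℓ] at this
        · intro x hx
          rw [Set.uIoc_of_le (by linarith)] at hx
          rw [norm_mul, norm_mul, norm_chr, mul_one]
          have h2 := norm_chr_sub_one_le (lam - lam₀) (x - a)
          rw [abs_mul] at h2
          have h3 : |x - a| ≤ ℓ := abs_le.2 ⟨by linarith [hx.1], by linarith [hx.2]⟩
          calc ‖g x‖ * ‖chr (lam - lam₀) (x - a) - 1‖
              ≤ C * (ε / (4 * C * ℓ) * ℓ) := by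
                refine mul_le_mul (hC x) (h2.trans ?_) (norm_nonneg _) hC0.le
                exact mul_le_mul hl.le h3 (abs_nonneg _) (by positivity)
            _ = ε / 4 := by field_simp
      exact (norm_add_le _ _).trans (by linarith [hw a])
  obtain ⟨T₂, h2⟩ := hcomp
  refine ⟨max T₁ T₂, lt_max_of_lt_left hT₁, fun T hT lam => ?_⟩
  rcases le_total M |lam| with h | h
  · exact h1 T ((le_max_left _ _).trans hT) lam h
  · exact h2 T ((le_max_right _ _).trans hT) lam (abs_le.1 h)

/-! ### Correlations on the circle, Parseval and the uniqueness theorem -/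

section Circle

variable {P : ℝ} [hP : Fact (0 < P)]

theorem memLp_two_of_bound {p : AddCircle P → ℂ} (hp : Measurable p) {C : ℝ}
    (hC : ∀ x, ‖p x‖ ≤ C) : MemLp p 2 haarAddCircle :=
  MemLp.of_bound hp.aestronglyMeasurable C (Eventually.of_forall hC)

theorem hasSum_norm_sq_fourierCoeff {p : AddCircle P → ℂ} (hp : MemLp p 2 haarAddCircle) :
    HasSum (fun n => ‖fourierCoeff p n‖ ^ 2) (∫ t, ‖p t‖ ^ 2 ∂haarAddCircle) := by
  have h := hasSum_sq_fourierCoeff hp.toLp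
  convert h using 1
  · ext n; rw [fourierCoeff_congr_ae hp.coeFn_toLp]
  · refine integral_congr_ae ?_
    filter_upwards [hp.coeFn_toLp] with x hx
    rw [hx]

/-- The correlation of two functions on the circle. -/
noncomputable def correlation (p q : AddCircle P → ℂ) (u : AddCircle P) : ℂ :=
  ∫ x, conj (p x) * q (x + u) ∂haarAddCircle

variable {p q : AddCircle P → ℂ} {C D : ℝ}

theorem norm_correlation_le (hC : ∀ x, ‖p x‖ ≤ C) (hD : ∀ x, ‖q x‖ ≤ D) (u : AddCircle P) :
    ‖correlation p q u‖ ≤ C * D := by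
  have := norm_integral_le_of_norm_le_const (μ := @haarAddCircle P hP)
    (f := fun x => conj (p x) * q (x + u)) (C := C * D) (Eventually.of_forall fun x => by
      rw [norm_mul, RCLike.norm_conj]
      exact mul_le_mul (hC x) (hD _) (norm_nonneg _) ((norm_nonneg _).trans (hC x)))
  rwa [probReal_univ, mul_one] at this

theorem measurable_correlation (hp : Measurable p) (hq : Measurable q) :
    Measurable (correlation p q) := by
  have : StronglyMeasurable fun z : AddCircle P × AddCircle P => conj (p z.2) * q (z.2 + z.1) := by
    refine Measurable.stronglyMeasurable ?_
    exact (Complex.continuous_conj.measurable.comp (hp.comp measurable_snd)).mul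
      (hq.comp (measurable_snd.add measurable_fst))
  exact this.integral_prod_right'.measurable

/-- Fubini together with the translation invariance of Haar measure separates the two integrals. -/
theorem fourierCoeff_correlation (hp : Measurable p) (hq : Measurable q)
    (hC : ∀ x, ‖p x‖ ≤ C) (hD : ∀ x, ‖q x‖ ≤ D) (n : ℤ) :
    fourierCoeff (correlation p q) n = conj (fourierCoeff p n) * fourierCoeff q n := by
  have hint : Integrable (Function.uncurry fun u x : AddCircle P =>
      fourier (-n) u * (conj (p x) * q (x + u))) (haarAddCircle.prod haarAddCircle) := by
    refine Integrable.of_bound (C := C * D) (Measurable.aestronglyMeasurable ?_)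
      (Eventually.of_forall fun z => ?_)
    · refine Measurable.mul ((fourier (-n)).continuous.measurable.comp measurable_fst) ?_
      exact (Complex.continuous_conj.measurable.comp (hp.comp measurable_snd)).mul
        (hq.comp (measurable_snd.add measurable_fst))
    · simp only [Function.uncurry, norm_mul, RCLike.norm_conj]
      have : ‖fourier (-n) z.1‖ = 1 := by rw [fourier_apply, Circle.norm_coe]
      rw [this, one_mul]
      exact mul_le_mul (hC _) (hD _) (norm_nonneg _) ((norm_nonneg _).trans (hC z.2))
  have hinner : ∀ x : AddCircle P, ∫ u, fourier (-n) u * (conj (p x) * q (x + u)) ∂haarAddCircle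
      = conj (fourier (-n) x * p x) * fourierCoeff q n := fun x => by
    have e : ∀ u, fourier (-n) u * (conj (p x) * q (x + u)) =
        conj (fourier (-n) x * p x) * (fourier (-n) (x + u) * q (x + u)) := fun u => by
      have h1 : conj (fourier (-n) x) * fourier (-n) (x + u) = fourier (-n) u := by
        rw [← fourier_neg, neg_neg]
        simp only [fourier_apply, ← Circle.coe_mul, ← toCircle_add]
        congr 2
        rw [smul_add, neg_smul, neg_smul]; abel
      rw [map_mul, ← h1]; ring
    simp_rw [e]
    rw [integral_const_mul, integral_add_left_eq_self (fun y => fourier (-n) y * q y) x]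
    simp [fourierCoeff]
  simp only [fourierCoeff, correlation, smul_eq_mul]
  simp_rw [← integral_const_mul]
  rw [integral_integral_swap hint]
  simp_rw [hinner]
  rw [integral_mul_const, integral_conj, integral_const_mul]
  rfl

/-- Parseval is used twice: the coefficients of the correlation are at most `η` times those of `p`,
whose squares sum to the mean square of `p`, at most `C ^ 2`. -/
theorem integral_norm_sq_correlation_le (hp : Measurable p) (hq : Measurable q)
    (hC : ∀ x, ‖p x‖ ≤ C) (hD : ∀ x, ‖q x‖ ≤ D) {η : ℝ} (hη : ∀ n, ‖fourierCoeff q n‖ ≤ η) :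
    ∫ u, ‖correlation p q u‖ ^ 2 ∂haarAddCircle ≤ η ^ 2 * C ^ 2 := by
  have h1 := hasSum_norm_sq_fourierCoeff
    (memLp_two_of_bound (measurable_correlation hp hq) (norm_correlation_le hC hD))
  have h2 := (hasSum_norm_sq_fourierCoeff (memLp_two_of_bound hp hC)).mul_left (η ^ 2)
  have h3 := hasSum_le (fun n => ?_) h1 h2
  · refine h3.trans (mul_le_mul_of_nonneg_left ?_ (sq_nonneg η))
    have := norm_integral_le_of_norm_le_const (μ := @haarAddCircle P hP)
      (f := fun x => ‖p x‖ ^ 2) (C := C ^ 2) (Eventually.of_forall fun x => by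
        rw [Real.norm_of_nonneg (sq_nonneg _)]
        exact pow_le_pow_left₀ (norm_nonneg _) (hC x) 2)
    simpa using (le_abs_self _).trans this
  · rw [fourierCoeff_correlation hp hq hC hD, norm_mul, RCLike.norm_conj, mul_pow, mul_comm]
    exact mul_le_mul_of_nonneg_right (pow_le_pow_left₀ (norm_nonneg _) (hη n) 2) (sq_nonneg _)

end Circle

/-- The correlation over `[0, T]` is transferred to a circle of length `2 * T`. Of the factor `(2 *
T) ^ 3`, two powers undo the normalisation inside the squared correlation and one that of the outer
integral. -/
theorem integral_norm_sq_autocorrelation_le {g : ℝ → ℂ} (hg : Continuous g) {C η T : ℝ}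
    (hC : ∀ x, ‖g x‖ ≤ C) (hT : 0 < T)
    (hη : ∀ lam : ℝ, ‖∫ x in (0 : ℝ)..(2 * T), g x * chr lam x‖ ≤ η * (2 * T)) :
    ∫ u in (0 : ℝ)..T, ‖∫ x in (0 : ℝ)..T, conj (g x) * g (x + u)‖ ^ 2
      ≤ (2 * T) ^ 3 * (η ^ 2 * C ^ 2) := by
  have h2T : 0 < 2 * T := by positivity
  have : Fact (0 < 2 * T) := ⟨h2T⟩
  -- Cutting one factor off at `T` prevents wrap-around: for `x` and `u` in `(0, T]` the point `x +
  -- u` stays in `(0, 2 * T]`.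
  set g₁ : ℝ → ℂ := Set.indicator (Set.Iic T) g with hg₁
  set p : AddCircle (2 * T) → ℂ := liftIoc (2 * T) 0 g₁ with hp
  set q : AddCircle (2 * T) → ℂ := liftIoc (2 * T) 0 g with hq
  have hpc : ∀ x ∈ Set.Ioc (0 : ℝ) (2 * T), p x = g₁ x := fun x hx =>
    liftIoc_coe_apply (by simpa using hx)
  have hqc : ∀ x ∈ Set.Ioc (0 : ℝ) (2 * T), q x = g x := fun x hx =>
    liftIoc_coe_apply (by simpa using hx)
  have hmeas : ∀ f : ℝ → ℂ, Measurable f → Measurable (liftIoc (2 * T) 0 f) := fun f hf => by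
    have : liftIoc (2 * T) 0 f = f ∘ Subtype.val ∘ (measurableEquivIoc (2 * T) 0) := rfl
    rw [this]
    exact hf.comp (measurable_subtype_coe.comp (measurableEquivIoc (2 * T) 0).measurable)
  have hbd : ∀ f : ℝ → ℂ, (∀ x, ‖f x‖ ≤ C) → ∀ x, ‖liftIoc (2 * T) 0 f x‖ ≤ C := fun f hf x => by
    have : liftIoc (2 * T) 0 f = f ∘ Subtype.val ∘ (measurableEquivIoc (2 * T) 0) := rfl
    rw [this]; exact hf _
  have hg₁C : ∀ x, ‖g₁ x‖ ≤ C := fun x => (norm_indicator_le_norm_self _ _).trans (hC x)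
  have hcircle : ∀ {E : Type} [NormedAddCommGroup E] [NormedSpace ℝ E]
      (F : AddCircle (2 * T) → E), ∫ x, F x ∂haarAddCircle
        = (2 * T)⁻¹ • ∫ x in (0 : ℝ)..(2 * T), F x := fun F => by
    rw [integral_haarAddCircle, ← AddCircle.intervalIntegral_preimage (2 * T) 0 F, zero_add]
  have hcoef : ∀ n, ‖fourierCoeff q n‖ ≤ η := fun n => by
    rw [fourierCoeff, hcircle, norm_smul, Real.norm_of_nonneg (by positivity),
      inv_mul_le_iff₀ h2T, mul_comm (2 * T)]
    refine le_of_eq_of_le ?_ (hη (2 * Real.pi * n / (2 * T)))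
    congr 1
    refine intervalIntegral.integral_congr_ae (Eventually.of_forall fun x hx => ?_)
    rw [Set.uIoc_of_le h2T.le] at hx
    rw [hqc x hx, smul_eq_mul, mul_comm, fourier_coe_apply, chr]
    push_cast
    congr 2
    ring
  have hcorr : ∀ u ∈ Set.Ioc 0 T, correlation p q (u : ℝ)
      = (2 * T : ℝ)⁻¹ • ∫ x in (0 : ℝ)..T, conj (g x) * g (x + u) := fun u hu => by
    have e : ∫ x in (0 : ℝ)..(2 * T), conj (p x) * q (x + u) =
        ∫ x in (0 : ℝ)..T, conj (g x) * g (x + u) := by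
      rw [intervalIntegral.integral_of_le h2T.le, intervalIntegral.integral_of_le hT.le]
      have hss : Set.Ioc 0 T ⊆ Set.Ioc 0 (2 * T) := Set.Ioc_subset_Ioc_right (by linarith)
      refine (setIntegral_eq_of_subset_of_forall_sdiff_eq_zero measurableSet_Ioc hss ?_).trans ?_
      rotate_left
      · refine setIntegral_congr_fun measurableSet_Ioc fun x hx => ?_
        rw [hpc x (hss hx), hg₁, Set.indicator_of_mem (by exact hx.2), ← AddCircle.coe_add, hqc]
        exact ⟨by linarith [hx.1, hu.1], by linarith [hx.2, hu.2]⟩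
      · intro x hx
        have : ¬ x ≤ T := fun h => hx.2 ⟨hx.1.1, h⟩
        rw [hpc x hx.1, hg₁, Set.indicator_of_notMem (by exact this), map_zero, zero_mul]
    rw [correlation, hcircle, e]
  have main := integral_norm_sq_correlation_le (p := p) (q := q)
    (hmeas _ (hg.measurable.indicator measurableSet_Iic)) (hmeas _ hg.measurable)
    (hbd _ hg₁C) (hbd _ hC) hcoef
  rw [hcircle, smul_eq_mul, inv_mul_le_iff₀ h2T] at main
  have hmc : Measurable fun u : ℝ => ‖correlation p q (u : AddCircle (2 * T))‖ ^ 2 :=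
    ((measurable_correlation (hmeas _ (hg.measurable.indicator measurableSet_Iic))
      (hmeas _ hg.measurable)).comp AddCircle.measurable_mk').norm.pow_const 2
  have hint : ∀ a b : ℝ, IntervalIntegrable
      (fun u : ℝ => ‖correlation p q (u : AddCircle (2 * T))‖ ^ 2) volume a b := fun a b => by
    refine (intervalIntegrable_const (c := (C * C) ^ 2)).mono_fun hmc.aestronglyMeasurable
      (Eventually.of_forall fun u => ?_)
    simp only [norm_pow, norm_norm]
    exact pow_le_pow_left₀ (norm_nonneg _)
      ((norm_correlation_le (hbd _ hg₁C) (hbd _ hC) _).trans (Real.le_norm_self _)) 2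
  have hle : ∫ u in (0 : ℝ)..T, ‖correlation p q (u : AddCircle (2 * T))‖ ^ 2
      ≤ ∫ u in (0 : ℝ)..(2 * T), ‖correlation p q (u : AddCircle (2 * T))‖ ^ 2 := by
    refine intervalIntegral.integral_mono_interval le_rfl hT.le (by linarith)
      (Eventually.of_forall fun u => sq_nonneg _) (hint _ _)
  have heq : ∫ u in (0 : ℝ)..T, ‖∫ x in (0 : ℝ)..T, conj (g x) * g (x + u)‖ ^ 2
      = (2 * T) ^ 2 * ∫ u in (0 : ℝ)..T, ‖correlation p q (u : AddCircle (2 * T))‖ ^ 2 := by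
    rw [← intervalIntegral.integral_const_mul]
    refine intervalIntegral.integral_congr_ae (Eventually.of_forall fun u hu => ?_)
    rw [Set.uIoc_of_le hT.le] at hu
    rw [hcorr u hu, norm_smul, Real.norm_of_nonneg (by positivity), ← mul_pow,
      mul_inv_cancel_left₀ h2T.ne']
  rw [heq]
  calc _ ≤ (2 * T) ^ 2 * (2 * T * (η ^ 2 * C ^ 2)) :=
        mul_le_mul_of_nonneg_left (hle.trans main) (by positivity)
    _ = _ := by ring

/-- A nonnegative function that is at least `d` on relatively dense windows has positive
lower mean. -/
theorem le_integral_of_relatively_dense {k : ℝ → ℝ} (hk : Continuous k) (hk0 : ∀ x, 0 ≤ k x)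
    {l δ d : ℝ} (hl : 0 < l) (hδ : 0 < δ) (hd : 0 ≤ d)
    (h : ∀ t₀ : ℝ, ∃ τ ∈ Set.Ioo t₀ (t₀ + l), ∀ x ∈ Set.Icc τ (τ + δ), d ≤ k x)
    {T : ℝ} (hT : l + δ ≤ T) : d * (δ / (2 * (l + δ))) * T ≤ ∫ x in (0 : ℝ)..T, k x := by
  have hi : ∀ u v : ℝ, IntervalIntegrable k volume u v := fun u v => hk.intervalIntegrable u v
  have hlδ : 0 < l + δ := by positivity
  have hstep : ∀ t : ℝ, d * δ ≤ ∫ x in t..(t + (l + δ)), k x := fun t => by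
    obtain ⟨τ, hτ, hx⟩ := h t
    have h1 : ∫ x in τ..(τ + δ), k x ≤ ∫ x in t..(t + (l + δ)), k x :=
      intervalIntegral.integral_mono_interval hτ.1.le (by linarith) (by linarith [hτ.2])
        (Eventually.of_forall fun u => hk0 u) (hi _ _)
    have h2 : ∫ x in τ..(τ + δ), d ≤ ∫ x in τ..(τ + δ), k x :=
      intervalIntegral.integral_mono_on (by linarith) (by simp) (hi _ _) hx
    rw [intervalIntegral.integral_const, add_sub_cancel_left, smul_eq_mul] at h2
    linarith
  have hn : ∀ n : ℕ, n * (d * δ) ≤ ∫ x in (0 : ℝ)..(n * (l + δ)), k x := by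
    intro n
    induction n with
    | zero => simp
    | succ n ih =>
      have e : ((n + 1 : ℕ) : ℝ) * (l + δ) = n * (l + δ) + (l + δ) := by push_cast; ring
      rw [e, ← intervalIntegral.integral_add_adjacent_intervals (hi 0 (n * (l + δ))) (hi _ _)]
      have := hstep (n * (l + δ))
      push_cast
      linarith
  have hTp : 0 < T := hlδ.trans_le hT
  have hfl := Nat.floor_le (show 0 ≤ T / (l + δ) by positivity)
  have hfl' := Nat.lt_floor_add_one (T / (l + δ))
  have h1N : (1 : ℝ) ≤ ⌊T / (l + δ)⌋₊ := by
    exact_mod_cast Nat.le_floor (by rw [Nat.cast_one, one_le_div hlδ]; exact hT)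
  set N := ⌊T / (l + δ)⌋₊
  have h3 : ∫ x in (0 : ℝ)..(N * (l + δ)), k x ≤ ∫ x in (0 : ℝ)..T, k x :=
    intervalIntegral.integral_mono_interval le_rfl (by positivity) ((le_div_iff₀ hlδ).1 hfl)
        (Eventually.of_forall fun u => hk0 u) (hi _ _)
  refine le_trans ?_ ((hn N).trans h3)
  have e : d * (δ / (2 * (l + δ))) * T = (T / (l + δ) / 2) * (d * δ) := by field_simp
  rw [e]
  exact mul_le_mul_of_nonneg_right (by linarith) (by positivity)

/-- **Uniqueness theorem**: an almost periodic function all of whose Fourier coefficients vanish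
is zero. -/
theorem HasCompactHull.eq_zero {g : ℝ → ℂ} (hg : HasCompactHull g)
    (hm : ∀ lam : ℝ, HasMean (fun x => g x * chr lam x) 0) (x₀ : ℝ) : g x₀ = 0 := by
  by_contra hne
  have hpos : 0 < ‖g x₀‖ := norm_pos_iff.2 hne
  have hgc := hg.continuous
  obtain ⟨C, hC0, hC⟩ := hg.isBohr.exists_bound
  -- A nonzero value recurs approximately at `x₀ + τ` for relatively dense `τ`, so the mean square
  -- of `g` has a positive lower bound `m`.
  obtain ⟨m, hm0, T₁, hT₁, hmT⟩ : ∃ m : ℝ, 0 < m ∧ ∃ T₁ : ℝ, 0 < T₁ ∧ ∀ T, T₁ ≤ T →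
      m * T ≤ ∫ x in (0 : ℝ)..T, ‖g x‖ ^ 2 := by
    obtain ⟨l, hl, hτ⟩ := hg.isBohr.2 (‖g x₀‖ / 4) (by positivity)
    obtain ⟨δ, hδ, hmod⟩ := hg.isBohr.exists_modulus (show 0 < ‖g x₀‖ / 4 by positivity)
    refine ⟨(‖g x₀‖ / 2) ^ 2 * (δ / 2 / (2 * (l + δ / 2))), by positivity, l + δ / 2, by positivity,
      fun T hT => le_integral_of_relatively_dense (hgc.norm.pow 2) (fun _ => sq_nonneg _) hl
        (half_pos hδ) (by positivity) (fun t₀ => ?_) hT⟩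
    obtain ⟨τ, hτm, hx⟩ := hτ (t₀ - x₀)
    refine ⟨x₀ + τ, ⟨by linarith [hτm.1], by linarith [hτm.2]⟩, fun x hxm => ?_⟩
    refine pow_le_pow_left₀ (by positivity) ?_ 2
    have h1 := hx x₀
    have h2 := hmod x (x₀ + τ) (abs_lt.2 ⟨by linarith [hxm.1], by linarith [hxm.2]⟩)
    have h3 : ‖g x₀‖ ≤ ‖g x‖ + ‖g x - g (x₀ + τ)‖ + ‖g (x₀ + τ) - g x₀‖ := by
      have e : g x₀ = g x - (g x - g (x₀ + τ)) - (g (x₀ + τ) - g x₀) := by ring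
      calc ‖g x₀‖ = ‖g x - (g x - g (x₀ + τ)) - (g (x₀ + τ) - g x₀)‖ := congrArg _ e
        _ ≤ _ := (norm_sub_le _ _).trans (add_le_add_left (norm_sub_le _ _) _)
    linarith
  -- The autocorrelation `H` is at least `m * T` at `0`. Shifts near a translation number alter it
  -- by at most `m * T / 2`, the tolerance `m / (4 * C)` being spent once on almost periodicity and
  -- once on continuity. So `H` is large on a set of shifts of density at least `κ`.
  obtain ⟨l, hl, hτ⟩ := hg.isBohr.2 (m / (4 * C)) (by positivity)
  obtain ⟨δ, hδ, hmod⟩ := hg.isBohr.exists_modulus (show 0 < m / (4 * C) by positivity)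
  set κ : ℝ := δ / 2 / (2 * (l + δ / 2)) with hκ
  have hκ0 : 0 < κ := by positivity
  -- Small Fourier integrals bound the integral of `‖H‖ ^ 2` by `8 * η ^ 2 * C ^ 2 * T ^ 3`, while
  -- recurrence forces at least `(m / 2) ^ 2 * κ * T ^ 3`; this `η` makes the two incompatible.
  obtain ⟨η, hη0, hη⟩ : ∃ η : ℝ, 0 < η ∧ 8 * (η ^ 2 * C ^ 2) < (m / 2) ^ 2 * κ := by
    have : Tendsto (fun η : ℝ => 8 * (η ^ 2 * C ^ 2)) (𝓝[>] 0) (𝓝 0) := by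
      refine tendsto_nhdsWithin_of_tendsto_nhds ?_
      have : Continuous fun η : ℝ => 8 * (η ^ 2 * C ^ 2) := by fun_prop
      simpa using this.tendsto 0
    obtain ⟨η, h1, h2⟩ := ((this.eventually_lt_const (show 0 < (m / 2) ^ 2 * κ by positivity)).and
      self_mem_nhdsWithin).exists
    exact ⟨η, h2, h1⟩
  obtain ⟨T₂, hT₂, hF⟩ := hg.uniform_fourier hm hη0
  set T : ℝ := max T₁ (max T₂ (l + δ / 2)) with hTdef
  have hT1 : T₁ ≤ T := le_max_left _ _
  have hT2 : T₂ ≤ T := (le_max_left _ _).trans (le_max_right _ _)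
  have hT3 : l + δ / 2 ≤ T := (le_max_right _ _).trans (le_max_right _ _)
  have hT0 : 0 < T := hT₁.trans_le hT1
  have hup := integral_norm_sq_autocorrelation_le hgc hC hT0 (η := η)
    (fun lam => hF (2 * T) (by linarith) lam)
  set H : ℝ → ℂ := fun u => ∫ x in (0 : ℝ)..T, conj (g x) * g (x + u) with hH
  have hHc : Continuous H := by
    refine intervalIntegral.continuous_parametric_intervalIntegral_of_continuous' ?_ _ _
    exact (Complex.continuous_conj.comp (hgc.comp continuous_snd)).mul
      (hgc.comp (continuous_snd.add continuous_fst))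
  have hH0 : m * T ≤ ‖H 0‖ := by
    have e : H 0 = ((∫ x in (0 : ℝ)..T, ‖g x‖ ^ 2 : ℝ) : ℂ) := by
      rw [hH, ← intervalIntegral.integral_ofReal]
      refine intervalIntegral.integral_congr fun x _ => ?_
      simp only [add_zero, Complex.conj_mul']
      push_cast; rfl
    rw [e, Complex.norm_real]
    exact (hmT T hT1).trans (le_abs_self _)
  have hlow := le_integral_of_relatively_dense (k := fun u => ‖H u‖ ^ 2) (hHc.norm.pow 2)
    (fun _ => sq_nonneg _) hl (half_pos hδ) (d := (m * T / 2) ^ 2) (sq_nonneg _) (fun t₀ => ?_) hT3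
  · have h1 := hlow.trans hup
    rw [← hκ] at h1
    have h2 : (m / 2) ^ 2 * κ * T ^ 3 ≤ 8 * (η ^ 2 * C ^ 2) * T ^ 3 := by linarith
    exact absurd (le_of_mul_le_mul_right h2 (by positivity)) (not_le.2 hη)
  · obtain ⟨τ, hτm, hx⟩ := hτ t₀
    refine ⟨τ, hτm, fun u hu => pow_le_pow_left₀ (by positivity) ?_ 2⟩
    have hdiff : ‖H u - H 0‖ ≤ m / 2 * T := by
      have hc : ∀ u, Continuous fun x => conj (g x) * g (x + u) := fun u =>
        (Complex.continuous_conj.comp hgc).mul (hgc.comp (continuous_add_const u))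
      rw [hH]
      simp only
      rw [← intervalIntegral.integral_sub ((hc u).intervalIntegrable _ _)
        ((hc 0).intervalIntegrable _ _)]
      refine (norm_integral_le_of_le (C := m / 2) (fun x => ?_) hT0.le).trans (by rw [sub_zero])
      rw [← mul_sub, norm_mul, RCLike.norm_conj, add_zero]
      have h1 := hx x
      have h2 := hmod (x + u) (x + τ) (abs_lt.2 ⟨by linarith [hu.1], by linarith [hu.2]⟩)
      have h3 : ‖g (x + u) - g x‖ ≤ m / (4 * C) + m / (4 * C) := by
        have e : g (x + u) - g x = (g (x + u) - g (x + τ)) + (g (x + τ) - g x) := by ring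
        rw [e]; exact (norm_add_le _ _).trans (add_le_add h2 h1)
      calc ‖g x‖ * ‖g (x + u) - g x‖ ≤ C * (m / (4 * C) + m / (4 * C)) :=
            mul_le_mul (hC x) h3 (norm_nonneg _) hC0.le
        _ = m / 2 := by field_simp; ring
    have h4 := norm_sub_norm_le (H 0) (H u)
    rw [norm_sub_rev] at h4
    linarith

/-! ### Calculus of mean values -/

theorem HasMean.const_mul {g : ℝ → ℂ} {m : ℂ} (hg : HasMean g m) (c : ℂ) :
    HasMean (fun t => c * g t) (c * m) := by
  have := Filter.Tendsto.const_mul c hg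
  refine this.congr fun T => ?_
  rw [intervalIntegral.integral_const_mul]; ring

theorem HasMean.sum {κ : Type*} {s : Finset κ} {g : κ → ℝ → ℂ} {m : κ → ℂ}
    (hc : ∀ i ∈ s, Continuous (g i)) (hg : ∀ i ∈ s, HasMean (g i) (m i)) :
    HasMean (fun t => ∑ i ∈ s, g i t) (∑ i ∈ s, m i) := by
  have := tendsto_finsetSum s hg
  refine this.congr fun T => ?_
  rw [intervalIntegral.integral_finsetSum fun i hi => (hc i hi).intervalIntegrable _ _,
    Finset.mul_sum]

theorem HasMean.sub {f g : ℝ → ℂ} {m n : ℂ} (hfc : Continuous f) (hgc : Continuous g)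
    (hf : HasMean f m) (hg : HasMean g n) : HasMean (fun t => f t - g t) (m - n) := by
  have := Filter.Tendsto.sub hf hg
  refine this.congr fun T => ?_
  rw [intervalIntegral.integral_sub (hfc.intervalIntegrable _ _) (hgc.intervalIntegrable _ _)]
  ring

/-- It serves twice: with `k` a Riesz product, and with `k = 1` in Kronecker's theorem. -/
theorem HasMean.norm_le {G k : ℝ → ℂ} {m M : ℂ} {C : ℝ}
    (hk : Continuous k) (hG : HasMean G m) (hkM : HasMean k M)
    (h : ∀ t, ‖G t‖ ≤ C * (k t).re) : ‖m‖ ≤ C * M.re := by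
  have h1 := hG.norm
  have h2 := ((Complex.continuous_re.tendsto M).comp hkM).const_mul C
  refine le_of_tendsto_of_tendsto h1 h2 ?_
  filter_upwards [eventually_gt_atTop 0] with T hT
  have e : (2 * (T : ℂ))⁻¹ = ((2 * T)⁻¹ : ℝ) := by push_cast; rfl
  have e2 : (∫ t in (-T)..T, k t).re = ∫ t in (-T)..T, (k t).re := by
    have := Complex.reCLM.intervalIntegral_comp_comm (hk.intervalIntegrable (μ := volume) (-T) T)
    exact this.symm
  simp only [Function.comp]
  rw [e, norm_mul, Complex.re_ofReal_mul, e2, Complex.norm_real,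
    Real.norm_of_nonneg (by positivity), mul_left_comm, ← intervalIntegral.integral_const_mul]
  refine mul_le_mul_of_nonneg_left ?_ (by positivity)
  exact intervalIntegral.norm_integral_le_of_norm_le (by linarith)
    (Eventually.of_forall fun t _ => h t)
    ((continuous_const.mul (Complex.continuous_re.comp hk)).intervalIntegrable _ _)

theorem norm_mean_chr_le {lam T : ℝ} (hT : 0 < T) :
    ‖(2 * (T : ℂ))⁻¹ * ∫ t in (-T)..T, chr lam t‖ ≤ 1 := by
  have e : (2 * (T : ℂ))⁻¹ = ((2 * T)⁻¹ : ℝ) := by push_cast; rfl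
  have := norm_integral_le_of_le (g := chr lam) (C := 1) (fun x => (norm_chr lam x).le)
    (show -T ≤ T by linarith)
  rw [norm_mul, e, Complex.norm_real, Real.norm_of_nonneg (by positivity),
    inv_mul_le_iff₀ (by positivity)]
  linarith

theorem hasMean_chr (lam : ℝ) : HasMean (chr lam) (if lam = 0 then 1 else 0) := by
  split_ifs with h
  · subst h
    refine tendsto_const_nhds.congr' ?_
    filter_upwards [eventually_gt_atTop 0] with T hT
    have : chr 0 = fun _ => 1 := by ext x; simp [chr]
    rw [this, intervalIntegral.integral_const]
    have hT' : (T : ℂ) ≠ 0 := by exact_mod_cast hT.ne'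
    rw [Complex.real_smul]
    push_cast
    field_simp
    ring
  · have hlam : (-(lam : ℂ) * Complex.I) ≠ 0 := by simpa using h
    have hint : ∀ T : ℝ, ‖∫ t in (-T)..T, chr lam t‖ ≤ 2 / |lam| := fun T => by
      have e : ∀ t : ℝ, chr lam t = Complex.exp ((-(lam : ℂ) * Complex.I) * t) := fun t => by
        rw [chr]; ring_nf
      have hn : ∀ t : ℝ, ‖Complex.exp ((-(lam : ℂ) * Complex.I) * t)‖ = 1 := fun t => by
        rw [← e, norm_chr]
      simp_rw [e]
      rw [integral_exp_mul_complex hlam, norm_div]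
      have hd : ‖-(lam : ℂ) * Complex.I‖ = |lam| := by simp
      rw [hd]
      refine div_le_div_of_nonneg_right ((norm_sub_le _ _).trans ?_) (abs_nonneg _)
      rw [hn, hn]; norm_num
    have h0 : Tendsto (fun T : ℝ => ‖(2 * (T : ℂ))⁻¹‖ * (2 / |lam|)) atTop (𝓝 (0 * (2 / |lam|))) := by
      refine Tendsto.mul_const _ ?_
      have : Tendsto (fun T : ℝ => (2 * T)⁻¹) atTop (𝓝 0) :=
        (tendsto_id.const_mul_atTop zero_lt_two).inv_tendsto_atTop
      rw [tendsto_zero_iff_norm_tendsto_zero] at this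
      refine this.congr fun T => ?_
      rw [← Complex.norm_real]; push_cast; rfl
    rw [zero_mul] at h0
    refine squeeze_zero_norm (fun T => ?_) h0
    rw [norm_mul]
    exact mul_le_mul_of_nonneg_left (hint T) (norm_nonneg _)

theorem chr_sum {κ : Type*} (s : Finset κ) (a : κ → ℝ) (x : ℝ) :
    chr (∑ i ∈ s, a i) x = ∏ i ∈ s, chr (a i) x := by
  simp only [chr]
  rw [← Complex.exp_sum]
  push_cast
  rw [Finset.sum_mul, ← Finset.sum_neg_distrib, Finset.sum_mul]

theorem conj_chr (lam x : ℝ) : conj (chr lam x) = chr (-lam) x := by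
  simp only [chr]
  rw [← Complex.exp_conj]
  simp

/-- The Fourier coefficients of an absolutely convergent sum of exponentials. -/
theorem hasMean_tsum_mul_chr {ι : Type*} [Countable ι] {A : ι → ℂ}
    (hA : Summable fun i => ‖A i‖) {ν : ι → ℝ} (lam : ℝ) :
    HasMean (fun x : ℝ => (∑' i, A i * Complex.exp (ν i * x * Complex.I)) * chr lam x)
      (∑' i, A i * if lam = ν i then 1 else 0) := by
  have e : ∀ i (x : ℝ), Complex.exp (ν i * x * Complex.I) * chr lam x = chr (lam - ν i) x := fun i x => by
    simp only [chr]; rw [← Complex.exp_add]; push_cast; ring_nf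
  have hlim : ∀ i, Tendsto (fun T : ℝ => A i * ((2 * (T : ℂ))⁻¹ * ∫ t in (-T)..T, chr (lam - ν i) t))
      atTop (𝓝 (A i * if lam = ν i then 1 else 0)) := fun i => by
    have := Filter.Tendsto.const_mul (A i) (hasMean_chr (lam - ν i))
    simpa only [sub_eq_zero] using this
  have hev : ∀ᶠ T : ℝ in atTop, ∀ i,
      ‖A i * ((2 * (T : ℂ))⁻¹ * ∫ t in (-T)..T, chr (lam - ν i) t)‖ ≤ ‖A i‖ := by
    filter_upwards [eventually_gt_atTop 0] with T hT i
    rw [norm_mul]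
    exact mul_le_of_le_one_right (norm_nonneg _) (norm_mean_chr_le hT)
  refine (tendsto_tsum_of_dominated_convergence hA hlim hev).congr fun T => ?_
  have key : ∀ t : ℝ, (∑' i, A i * Complex.exp (ν i * t * Complex.I)) * chr lam t
      = ∑' i, A i * chr (lam - ν i) t := fun t => by
    rw [← tsum_mul_right]
    exact tsum_congr fun i => by rw [mul_assoc, e]
  simp_rw [key]
  have hs := intervalIntegral.hasSum_intervalIntegral_of_summable_norm (a := -T) (b := T)
    (f := fun i => (⟨fun t => A i * chr (lam - ν i) t, by fun_prop⟩ : C(ℝ, ℂ))) ?_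
  · simp only [ContinuousMap.coe_mk] at hs
    rw [← hs.tsum_eq, ← tsum_mul_left]
    refine tsum_congr fun i => ?_
    rw [intervalIntegral.integral_const_mul]; ring
  · refine Summable.of_nonneg_of_le (fun i => norm_nonneg _) (fun i => ?_) hA
    refine (ContinuousMap.norm_le _ (norm_nonneg _)).2 fun x => ?_
    simp [norm_chr]

/-! ### Independent exponents, Riesz products and absolute convergence -/

section Independent

variable {ι : Type*} {ν : ι → ℝ}

theorem linearIndependent_int (hind : LinearIndependent ℚ ν) : LinearIndependent ℤ ν :=
  hind.restrict_scalars fun a b h => by simpa using h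

theorem eq_zero_of_sum_int_mul_eq_zero (hind : LinearIndependent ℤ ν) {s : Finset ι}
    {x : s → ℤ} (hx : ∑ i, x i * ν i = 0) : x = 0 := by
  have h := hind.comp (Subtype.val : s → ι) Subtype.val_injective
  ext i
  exact Fintype.linearIndependent_iff.1 h x (by simpa using hx) i

/-- It shows which frequencies of a Riesz product over `s` meet the spectrum. The exponent `ν j` may
a priori lie outside `s`; adjoining `j` with coefficient `-1` would then give a nontrivial relation.
-/
theorem eq_single_of_sum_int_mul_eq [DecidableEq ι] (hind : LinearIndependent ℤ ν) {s : Finset ι}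
    {x : s → ℤ} {j : ι} (hx : ∑ i, x i * ν i = ν j) : ∃ k : s, k = j ∧ x = Pi.single k 1 := by
  by_cases hj : j ∈ s
  · refine ⟨⟨j, hj⟩, rfl, sub_eq_zero.1 (eq_zero_of_sum_int_mul_eq_zero hind ?_)⟩
    have e : ∑ i, ((Pi.single (⟨j, hj⟩ : s) (1 : ℤ) : s → ℤ) i : ℝ) * ν i = ν j := by
      rw [Finset.sum_eq_single (⟨j, hj⟩ : s)]
      · simp
      · intro b _ hb
        simp [Pi.single_eq_of_ne hb]
      · simp
    simp only [Pi.sub_apply, Int.cast_sub, sub_mul, Finset.sum_sub_distrib]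
    rw [hx, e, sub_self]
  · exfalso
    have h := linearIndependent_iff'.1 hind (insert j s)
      (fun i => if h : i ∈ s then x ⟨i, h⟩ else -1) ?_ j (Finset.mem_insert_self _ _)
    · simp [hj] at h
    · rw [Finset.sum_insert hj, ← Finset.sum_coe_sort s]
      have hx' : ∑ i ∈ s.attach, x i * ν i = ν j := hx
      simp [hj, hx']

end Independent

/-- The weights of a factor `1 + cos` of a Riesz product. -/
noncomputable def rieszWeight (u : ℂ) (k : ℤ) : ℂ :=
  -- The last branch is meant for `k = -1`; only `-1`, `0` and `1` occur as frequencies.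
  if k = 0 then 1 else if k = 1 then conj u / 2 else u / 2

theorem sum_rieszWeight_mul_chr (u : ℂ) (lam t : ℝ) :
    ∑ k ∈ ({-1, 0, 1} : Finset ℤ), rieszWeight u k * chr (k * lam) t
      = ((1 + (conj u * chr lam t).re : ℝ) : ℂ) := by
  have h1 : conj u * chr lam t + conj (conj u * chr lam t) = ((2 * (conj u * chr lam t).re : ℝ) : ℂ) :=
    Complex.add_conj _
  rw [map_mul, conj_chr, Complex.conj_conj] at h1
  have h0 : chr 0 t = 1 := by simp [chr]
  rw [Finset.sum_insert (by decide), Finset.sum_insert (by decide), Finset.sum_singleton]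
  simp only [rieszWeight]
  have h3 : (-1 : ℤ) ≠ 1 := by decide
  simp only [h3, neg_eq_zero, one_ne_zero, if_false, if_true, Int.cast_neg, Int.cast_one,
    Int.cast_zero, zero_mul, one_mul, neg_one_mul, h0]
  push_cast at h1 ⊢
  linear_combination h1 / 2

/-- **Bohr's theorem**: the Fourier series of a bounded function whose exponents are linearly
independent converges absolutely. -/
theorem sum_norm_le_of_linearIndependent {ι : Type*} {F : ℝ → ℂ} (hF : Continuous F) {C : ℝ}
    (hC : ∀ x, ‖F x‖ ≤ C) {A : ι → ℂ} {ν : ι → ℝ} (hind : LinearIndependent ℤ ν)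
    (hA : ∀ i, HasMean (fun t => F t * chr (ν i) t) (A i))
    (h0 : ∀ μ, μ ∉ Set.range ν → HasMean (fun t => F t * chr μ t) 0) (s : Finset ι) :
    ∑ i ∈ s, ‖A i‖ ≤ 2 * C := by
  classical
  -- The phase of each coefficient is built into the kernel, so that each selected coefficient
  -- contributes its modulus.
  choose u hu1 hu2 using fun i => show ∃ u : ℂ, ‖u‖ = 1 ∧ conj u * A i = ‖A i‖ by
    by_cases h : A i = 0
    · exact ⟨1, by simp, by simp [h]⟩
    · have hn : (‖A i‖ : ℂ) ≠ 0 := by exact_mod_cast norm_ne_zero_iff.2 h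
      refine ⟨A i / ‖A i‖, by simp [h], ?_⟩
      rw [map_div₀, Complex.conj_ofReal, div_mul_eq_mul_div, Complex.conj_mul', sq,
        mul_div_assoc, div_self hn, mul_one]
  set X : Finset (s → ℤ) := Fintype.piFinset fun _ => ({-1, 0, 1} : Finset ℤ) with hX
  set W : (s → ℤ) → ℂ := fun x => ∏ i : s, rieszWeight (u i) (x i) with hW
  set fr : (s → ℤ) → ℝ := fun x => ∑ i : s, x i * ν i with hfr
  set K : ℝ → ℝ := fun t => ∏ i : s, (1 + (conj (u i) * chr (ν i) t).re) with hK
  have hexp : ∀ t, (K t : ℂ) = ∑ x ∈ X, W x * chr (fr x) t := fun t => by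
    rw [hK]
    push_cast [← sum_rieszWeight_mul_chr]
    simp only [← Complex.ofReal_one, ← Complex.ofReal_add, ← sum_rieszWeight_mul_chr]
    rw [Finset.prod_univ_sum]
    refine Finset.sum_congr rfl fun x _ => ?_
    rw [Finset.prod_mul_distrib, hfr, chr_sum]
  have hK0 : ∀ t, 0 ≤ K t := fun t => by
    refine Finset.prod_nonneg fun i _ => ?_
    have := Complex.abs_re_le_norm (conj (u i) * chr (ν i) t)
    rw [norm_mul, RCLike.norm_conj, hu1, norm_chr, one_mul] at this
    linarith [(abs_le.1 this).1]
  have hmK : HasMean (fun t => (K t : ℂ)) 1 := by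
    simp_rw [hexp]
    have := HasMean.sum (s := X) (g := fun x t => W x * chr (fr x) t)
      (fun x _ => by fun_prop) (fun x _ => (hasMean_chr (fr x)).const_mul (W x))
    convert this using 1
    -- By independence only the zero multi-index has frequency `0`, hence the kernel has mean 1.
    rw [Finset.sum_eq_single (0 : s → ℤ)]
    · simp [hfr, hW, rieszWeight]
    · intro x _ hx
      rw [if_neg, mul_zero]
      exact fun h => hx (eq_zero_of_sum_int_mul_eq_zero hind h)
    · intro h
      exact absurd (by simp [hX]) h
  have hcoef : ∀ x, HasMean (fun t => F t * chr (fr x) t)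
      (∑ j : s, if x = Pi.single j 1 then A j else 0) := fun x => by
    by_cases hx : fr x ∈ Set.range ν
    · obtain ⟨j, hj⟩ := hx
      obtain ⟨k, rfl, rfl⟩ := eq_single_of_sum_int_mul_eq hind hj.symm
      rw [← hj]
      convert hA k using 1
      rw [Finset.sum_eq_single k]
      · simp
      · intro b _ hb
        rw [if_neg]
        intro h
        have := congrFun h k
        rw [Pi.single_eq_same, Pi.single_eq_of_ne hb.symm] at this
        exact one_ne_zero this
      · simp
    · convert h0 _ hx using 1
      refine Finset.sum_eq_zero fun j _ => if_neg ?_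
      rintro rfl
      refine hx ⟨j, ?_⟩
      rw [hfr]
      simp only
      rw [Finset.sum_eq_single j]
      · simp
      · intro b _ hb
        simp [Pi.single_eq_of_ne hb]
      · simp
  -- Of all frequencies of the kernel, only the unit multi-indices meet the spectrum of `F`, each
  -- with weight `conj (u j) / 2`. This one half is the source of the constant in `2 * C`.
  have hmFK : HasMean (fun t => F t * (K t : ℂ)) (∑ j : s, (‖A j‖ / 2 : ℂ)) := by
    have h := HasMean.sum (s := X) (g := fun x t => W x * (F t * chr (fr x) t))
      (fun x _ => by fun_prop) (fun x _ => (hcoef x).const_mul (W x))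
    have e : (fun t => F t * (K t : ℂ)) = fun t => ∑ x ∈ X, W x * (F t * chr (fr x) t) := by
      ext t
      rw [hexp, Finset.mul_sum]
      exact Finset.sum_congr rfl fun x _ => by ring
    rw [e]
    convert h using 1
    simp_rw [Finset.mul_sum]
    rw [Finset.sum_comm]
    refine Finset.sum_congr rfl fun j _ => ?_
    have hmem : (Pi.single j 1 : s → ℤ) ∈ X := by
      rw [hX, Fintype.mem_piFinset]
      intro i
      by_cases hi : i = j
      · subst hi; simp
      · simp [Pi.single_eq_of_ne hi]
    rw [Finset.sum_eq_single (Pi.single j 1 : s → ℤ)]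
    · have hWj : W (Pi.single j 1) = conj (u j) / 2 := by
        rw [hW]
        simp only
        rw [Finset.prod_eq_single j]
        · simp [rieszWeight]
        · intro b _ hb
          simp [Pi.single_eq_of_ne hb, rieszWeight]
        · simp
      rw [if_pos rfl, hWj, ← hu2 j]; ring
    · intro b _ hb
      rw [if_neg hb, mul_zero]
    · exact fun h => absurd hmem h
  have hKc : Continuous fun t => (K t : ℂ) := by simp_rw [hexp]; fun_prop
  have hfin := hmFK.norm_le (C := C) hKc hmK fun t => by
    rw [norm_mul, Complex.norm_real, Real.norm_of_nonneg (hK0 t), Complex.ofReal_re]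
    exact mul_le_mul_of_nonneg_right (hC t) (hK0 t)
  have e : ∑ j : s, (‖A j‖ / 2 : ℂ) = ((∑ i ∈ s, ‖A i‖) / 2 : ℝ) := by
    rw [← Finset.sum_coe_sort s]
    push_cast
    rw [Finset.sum_div]
  rw [e, Complex.norm_real, Real.norm_of_nonneg (by positivity), Complex.one_re] at hfin
  linarith

theorem countable_of_summable {ι : Type*} {r : ι → ℝ} (hr : Summable r) (h : ∀ i, r i ≠ 0) : Countable ι := by
  have hc := hr.countable_support
  have e : Function.support r = Set.univ := by
    ext i; simp [h i]
  rw [e] at hc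
  exact Set.countable_univ_iff.1 hc

/-- A Bohr almost periodic function with linearly independent exponents is the sum of its
absolutely convergent Fourier series. -/
theorem IsBohr.hasSum_fourier {ι : Type*} {F : ℝ → ℂ} (hF : IsBohr F) {A : ι → ℂ} {ν : ι → ℝ}
    (hA0 : ∀ i, A i ≠ 0) (hind : LinearIndependent ℚ ν)
    (hA : ∀ i, HasMean (fun t => F t * chr (ν i) t) (A i))
    (h0 : ∀ μ, μ ∉ Set.range ν → HasMean (fun t => F t * chr μ t) 0) :
    Summable (fun i => ‖A i‖) ∧
      ∀ t : ℝ, HasSum (fun i => A i * Complex.exp (ν i * t * Complex.I)) (F t) := by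
  classical
  obtain ⟨C, -, hC⟩ := hF.exists_bound
  have hs : Summable fun i => ‖A i‖ := summable_of_sum_le (fun i => norm_nonneg _)
    (sum_norm_le_of_linearIndependent hF.1 hC (linearIndependent_int hind) hA h0)
  refine ⟨hs, fun t => ?_⟩
  have hcount : Countable ι := countable_of_summable hs fun i => norm_ne_zero_iff.2 (hA0 i)
  have hS := hasCompactHull_tsum hs ν
  -- The difference between `F` and the sum of its series has only zero Fourier coefficients, so
  -- uniqueness applies.
  have hg : HasCompactHull fun x => F x + (-1) * ∑' i, A i * Complex.exp (ν i * x * Complex.I) := by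
    refine hF.hasCompactHull.add (HasCompactHull.mul (f := fun _ => -1) ?_ hS)
    exact ⟨{-1}, isCompact_singleton, fun t => ⟨-1, rfl, fun x => rfl⟩⟩
  have hz := hg.eq_zero (fun lam => ?_) t
  · have hsum : Summable fun i => A i * Complex.exp (ν i * t * Complex.I) := by
      refine Summable.of_norm_bounded hs fun i => ?_
      rw [norm_mul, norm_exp_ofReal_mul_I', mul_one]
    convert hsum.hasSum using 1
    linear_combination hz
  · have h2 := hasMean_tsum_mul_chr hs (ν := ν) lam
    have h1 : HasMean (fun t => F t * chr lam t) (∑' i, A i * if lam = ν i then 1 else 0) := by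
      by_cases hl : lam ∈ Set.range ν
      · obtain ⟨j, rfl⟩ := hl
        rw [tsum_eq_single j]
        · simpa using hA j
        · intro b hb
          rw [if_neg (fun h => hb (hind.injective h.symm)), mul_zero]
      · convert h0 lam hl using 1
        have hz : ∀ i, (A i * if lam = ν i then 1 else 0) = 0 := fun i => by
          rw [if_neg (fun h => hl ⟨i, h.symm⟩), mul_zero]
        simp_rw [hz]
        exact tsum_zero
    have h3 := HasMean.sub (hF.1.mul (continuous_chr lam)) (hS.continuous.mul (continuous_chr lam))
      h1 h2
    rw [sub_self] at h3
    convert h3 using 2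
    simp only [Pi.mul_apply]
    ring

/-! ### Closing polygons with prescribed side lengths -/

theorem tsum_eq_add_tsum_ne {ι E : Type*} [NormedAddCommGroup E] [CompleteSpace E] {f : ι → E}
    (hf : Summable f) (j : ι) : ∑' i, f i = f j + ∑' i : {i : ι // i ≠ j}, f i := by
  have h := (hf.subtype ({j} : Set ι)).tsum_add_tsum_compl (hf.subtype ({j} : Set ι)ᶜ)
  exact h.symm.trans (congrArg (· + _) (tsum_singleton j f))

/-- Signs can be chosen so that a finite sum of reals of size at most `R` stays in `[-R, R]`. -/
theorem exists_sign_sum_le {κ : Type*} {r : κ → ℝ} {R : ℝ} (hR : 0 ≤ R) (h0 : ∀ i, 0 ≤ r i)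
    (h : ∀ i, r i ≤ R) (s : Finset κ) :
    ∃ θ : κ → Circle, ∃ x : ℝ, ∑ i ∈ s, (r i : ℂ) * (θ i : ℂ) = x ∧ |x| ≤ R := by
  classical
  induction s using Finset.induction_on with
  | empty => exact ⟨1, 0, by simp, by simpa using hR⟩
  | insert a s ha ih =>
    obtain ⟨θ, x, hx, hxR⟩ := ih
    rw [abs_le] at hxR
    have key : ∀ c : Circle, ∑ i ∈ insert a s, (r i : ℂ) * (Function.update θ a c i : ℂ)
        = r a * c + x := fun c => by
      rw [Finset.sum_insert ha, Function.update_self, ← hx]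
      congr 1
      refine Finset.sum_congr rfl fun i hi => ?_
      rw [Function.update_of_ne (ne_of_mem_of_not_mem hi ha)]
    -- The new term gets the sign opposite to the partial sum, so the result cannot leave `[-R, R]`.
    rcases le_total 0 x with hx0 | hx0
    · refine ⟨Function.update θ a (-1), x - r a, ?_, abs_le.2 ⟨by linarith [h a], ?_⟩⟩
      · rw [key]; push_cast; ring
      · linarith [h0 a, hxR.2]
    · refine ⟨Function.update θ a 1, x + r a, ?_, abs_le.2 ⟨?_, by linarith [h a]⟩⟩
      · rw [key]; push_cast; ring
      · linarith [h0 a, hxR.1]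

/-- The sums of planar vectors of prescribed lengths, all at most `R`, attain the length `R` as
soon as the total length is at least `R`. -/
theorem exists_circle_norm_tsum_eq {κ : Type*} {r : κ → ℝ} {R : ℝ} (hR : 0 ≤ R)
    (h0 : ∀ i, 0 ≤ r i) (h : ∀ i, r i ≤ R) (hs : Summable r) (hle : R ≤ ∑' i, r i) :
    ∃ θ : κ → Circle, ‖∑' i, (r i : ℂ) * (θ i : ℂ)‖ = R := by
  have hnorm : ∀ i (c : Circle), ‖(r i : ℂ) * (c : ℂ)‖ = r i := fun i c => by
    rw [norm_mul, Circle.norm_coe, mul_one, Complex.norm_real, Real.norm_of_nonneg (h0 i)]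
  have hsθ : ∀ θ : κ → Circle, Summable fun i => (r i : ℂ) * (θ i : ℂ) := fun θ =>
    Summable.of_norm_bounded hs fun i => (hnorm _ _).le
  have hc : Continuous fun θ : κ → Circle => ‖∑' i, (r i : ℂ) * (θ i : ℂ)‖ :=
    (continuous_tsum (fun i => by fun_prop) hs fun i θ => (hnorm _ _).le).norm
  have hhigh : R ≤ ‖∑' i, (r i : ℂ) * (((1 : κ → Circle) i : Circle) : ℂ)‖ := by
    refine hle.trans (le_of_eq ?_)
    simp only [Pi.one_apply, Circle.coe_one, mul_one]
    rw [← Complex.ofReal_tsum, Complex.norm_real, Real.norm_of_nonneg (tsum_nonneg h0)]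
  -- Signs are available only for finite sums. The minimum over the compact torus is at most `R`
  -- plus the tail for every finite set, hence at most `R`. Connectedness of the torus then yields
  -- the value `R` exactly.
  obtain ⟨θ₀, -, hθ₀⟩ := isCompact_univ.exists_isMinOn Set.univ_nonempty hc.continuousOn
  have hlow : ‖∑' i, (r i : ℂ) * (θ₀ i : ℂ)‖ ≤ R := by
    have hlim : Tendsto (fun s : Finset κ => R + (∑' i, r i - ∑ i ∈ s, r i)) atTop
        (𝓝 (R + (∑' i, r i - ∑' i, r i))) := (hs.hasSum.const_sub _).const_add _
    rw [sub_self, add_zero] at hlim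
    refine ge_of_tendsto' hlim fun s => ?_
    obtain ⟨θ, x, hx, hxR⟩ := exists_sign_sum_le hR h0 h s
    refine (hθ₀ (Set.mem_univ θ)).trans ?_
    have e1 := (hsθ θ).sum_add_tsum_subtype_compl s
    have e2 := hs.sum_add_tsum_subtype_compl s
    have h1 : ‖∑' i : {i : κ // i ∉ s}, (r i : ℂ) * (θ i : ℂ)‖ ≤ ∑' i : {i : κ // i ∉ s}, r i :=
      tsum_of_norm_bounded (hs.subtype _).hasSum fun i => (hnorm _ _).le
    simp only
    rw [← e1, ← e2, hx, add_sub_cancel_left]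
    refine (norm_add_le _ _).trans (add_le_add ?_ h1)
    rwa [Complex.norm_real]
  exact mem_range_of_exists_le_of_exists_ge hc ⟨θ₀, hlow⟩ ⟨1, hhigh⟩

/-- A summable family of lengths, none larger than the sum of the others, closes up to a
polygon. -/
theorem exists_circle_tsum_eq_zero {ι : Type*} {r : ι → ℝ} (hr : ∀ i, 0 < r i) (hs : Summable r)
    (h : ∀ j, r j ≤ ∑' i : {i : ι // i ≠ j}, r i) :
    ∃ θ : ι → Circle, ∑' i, (r i : ℂ) * (θ i : ℂ) = 0 := by
  classical
  rcases isEmpty_or_nonempty ι with hι | ⟨⟨i₀⟩⟩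
  · exact ⟨1, by simp⟩
  -- A longest side exists because the lengths tend to zero. The other sides are arranged to have a
  -- sum of length `r j`, and the side `j` is pointed against it.
  obtain ⟨j, hj⟩ : ∃ j, ∀ i, r i ≤ r j := by
    have hfin : {i | r i₀ ≤ r i}.Finite := by
      have := hs.tendsto_cofinite_zero.eventually_lt_const (hr i₀)
      rw [eventually_cofinite] at this
      simpa only [not_lt] using this
    obtain ⟨j, hj, hmax⟩ := Set.exists_max_image _ r hfin ⟨i₀, le_refl (r i₀)⟩
    refine ⟨j, fun i => ?_⟩
    by_cases hi : r i₀ ≤ r i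
    · exact hmax i hi
    · exact (not_le.1 hi).le.trans hj
  obtain ⟨θ, hθ⟩ := exists_circle_norm_tsum_eq (r := fun i : {i : ι // i ≠ j} => r i) (hr j).le
    (fun i => (hr i).le) (fun i => hj i) (hs.subtype _) (h j)
  have hrj : (r j : ℂ) ≠ 0 := by exact_mod_cast (hr j).ne'
  obtain ⟨c, hc⟩ : ∃ c : Circle,
      (c : ℂ) = -(∑' i : {i : ι // i ≠ j}, (r i : ℂ) * (θ i : ℂ)) / r j := by
    have hn : ‖-(∑' i : {i : ι // i ≠ j}, (r i : ℂ) * (θ i : ℂ)) / r j‖ = 1 := by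
      rw [norm_div, norm_neg, hθ, Complex.norm_real, Real.norm_of_nonneg (hr j).le,
        div_self (hr j).ne']
    exact ⟨⟨_, mem_sphere_zero_iff_norm.2 hn⟩, rfl⟩
  have hsum : Summable fun i =>
      (r i : ℂ) * ((if hi : i = j then c else θ ⟨i, hi⟩ : Circle) : ℂ) :=
    Summable.of_norm_bounded hs fun i => by
      rw [norm_mul, Circle.norm_coe, mul_one, Complex.norm_real, Real.norm_of_nonneg (hr i).le]
  refine ⟨fun i => if hi : i = j then c else θ ⟨i, hi⟩, ?_⟩
  rw [tsum_eq_add_tsum_ne hsum j, dif_pos rfl, hc, mul_div_cancel₀ _ hrj, neg_add_eq_zero]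
  exact tsum_congr fun i => by rw [dif_neg i.2]

/-! ### Kronecker's theorem on the torus -/

section Kronecker

variable {d : Type*}

theorem integral_mFourier [Fintype d] (n : d → ℤ) :
    ∫ x, UnitAddTorus.mFourier n x ∂(Measure.pi fun _ : d => (AddCircle.haarAddCircle (T := 1)))
      = if n = 0 then 1 else 0 := by
  have h1 : ∀ k : ℤ, ∫ x, fourier k x ∂(AddCircle.haarAddCircle (T := 1)) = if k = 0 then 1 else 0 := by
    intro k
    have := congrFun (fourierCoeff_fourier (T := 1) k) 0
    simp only [fourierCoeff, neg_zero, fourier_zero, one_smul] at this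
    rw [this, Pi.single_apply]
    simp only [eq_comm]
  simp only [UnitAddTorus.mFourier, ContinuousMap.coe_mk]
  rw [integral_fintype_prod_eq_prod (fun i x => (fourier (n i) : C(UnitAddCircle, ℂ)) x)]
  simp_rw [h1]
  split_ifs with h
  · simp [h]
  · obtain ⟨i, hi⟩ := Function.ne_iff.1 h
    exact Finset.prod_eq_zero (Finset.mem_univ i) (if_neg hi)

/-- The line of slope `ν` on the torus. -/
noncomputable def torusLine (ν : d → ℝ) (t : ℝ) : UnitAddTorus d :=
  fun i => ((ν i * t / (2 * Real.pi) : ℝ) : UnitAddCircle)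

theorem continuous_torusLine (ν : d → ℝ) : Continuous (torusLine ν) := by
  refine continuous_pi fun i => ?_
  exact (AddCircle.continuous_mk' 1).comp (by fun_prop)

theorem toCircle_torusLine (ν : d → ℝ) (t : ℝ) (i : d) :
    AddCircle.toCircle (torusLine ν t i) = Circle.exp (ν i * t) := by
  rw [torusLine, AddCircle.toCircle_apply_mk]
  congr 1
  field_simp

theorem mFourier_torusLine [Fintype d] (ν : d → ℝ) (n : d → ℤ) (t : ℝ) :
    UnitAddTorus.mFourier n (torusLine ν t) = chr (-∑ i, n i * ν i) t := by
  simp only [UnitAddTorus.mFourier, ContinuousMap.coe_mk, fourier_apply, AddCircle.toCircle_zsmul,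
    toCircle_torusLine]
  rw [← Finset.sum_neg_distrib, chr_sum]
  refine Finset.prod_congr rfl fun i _ => ?_
  rw [Circle.coe_zpow, Circle.coe_exp, ← Complex.exp_int_mul, chr]
  push_cast
  ring_nf

/-- Trigonometric polynomials have the same mean along the line as on the torus. -/
theorem hasMean_torusLine [Fintype d] {ν : d → ℝ}
    (hind : ∀ n : d → ℤ, ∑ i, n i * ν i = 0 → n = 0) {p : C(UnitAddTorus d, ℂ)}
    (hp : p ∈ Submodule.span ℂ (Set.range (UnitAddTorus.mFourier (d := d)))) :
    HasMean (fun t => p (torusLine ν t))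
      (∫ x, p x ∂(Measure.pi fun _ : d => (AddCircle.haarAddCircle (T := 1)))) := by
  induction hp using Submodule.span_induction with
  | mem p hp =>
    obtain ⟨n, rfl⟩ := hp
    rw [integral_mFourier]
    simp_rw [mFourier_torusLine]
    convert hasMean_chr _ using 1
    refine if_congr ?_ rfl rfl
    rw [neg_eq_zero]
    exact ⟨fun h => by simp [h], hind n⟩
  | zero => simp [HasMean]
  | add p q _ _ hp hq =>
    have hi : ∀ p : C(UnitAddTorus d, ℂ), Integrable p
        (Measure.pi fun _ : d => (AddCircle.haarAddCircle (T := 1))) := fun p =>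
      p.continuous.integrable_of_hasCompactSupport (HasCompactSupport.of_compactSpace _)
    have hc : ∀ p : C(UnitAddTorus d, ℂ), Continuous fun t => p (torusLine ν t) := fun p =>
      p.continuous.comp (continuous_torusLine ν)
    simp only [ContinuousMap.add_apply]
    rw [integral_add (hi p) (hi q)]
    refine (Filter.Tendsto.add hp hq).congr fun T => ?_
    rw [intervalIntegral.integral_add ((hc p).intervalIntegrable _ _)
      ((hc q).intervalIntegrable _ _)]
    ring
  | smul c p _ hp =>
    simp only [ContinuousMap.smul_apply, smul_eq_mul, integral_const_mul]
    exact hp.const_mul c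

/-- Trigonometric polynomials are dense. One close to `B` is small along the line, so its mean
there, which is its torus integral, is at most `‖B - p‖`. Hence `‖∫ B‖ ≤ 2 * ‖B - p‖` for every such
`p`. -/
theorem integral_eq_zero_of_torusLine [Fintype d] {ν : d → ℝ}
    (hind : ∀ n : d → ℤ, ∑ i, n i * ν i = 0 → n = 0) (B : C(UnitAddTorus d, ℂ))
    (hB0 : ∀ t, B (torusLine ν t) = 0) :
    ∫ x, B x ∂(Measure.pi fun _ : d => (AddCircle.haarAddCircle (T := 1))) = 0 := by
  have hi : ∀ p : C(UnitAddTorus d, ℂ), Integrable p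
      (Measure.pi fun _ : d => (AddCircle.haarAddCircle (T := 1))) := fun p =>
    p.continuous.integrable_of_hasCompactSupport (HasCompactSupport.of_compactSpace _)
  have hB : B ∈ closure
      (Submodule.span ℂ (Set.range (UnitAddTorus.mFourier (d := d))) : Set C(UnitAddTorus d, ℂ)) := by
    rw [← Submodule.topologicalClosure_coe, UnitAddTorus.span_mFourier_closure_eq_top]
    exact Set.mem_univ B
  by_contra hne
  have hpos := norm_pos_iff.2 hne
  obtain ⟨p, hp, hpB⟩ := Metric.mem_closure_iff.1 hB _ (half_pos hpos)
  rw [dist_eq_norm] at hpB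
  have hd : ∀ x, ‖B x - p x‖ ≤ ‖B - p‖ := fun x => (B - p).norm_coe_le_norm x
  have hone : HasMean (fun _ => 1) 1 := by
    have := hasMean_chr 0
    rw [if_pos rfl] at this
    convert this using 2
    simp [chr]
  have hle : ∀ t, ‖p (torusLine ν t)‖ ≤ ‖B - p‖ * (1 : ℂ).re := fun t => by
    have := hd (torusLine ν t)
    rw [hB0, zero_sub, norm_neg] at this
    simpa only [Complex.one_re, mul_one] using this
  have h1 := (hasMean_torusLine hind hp).norm_le continuous_const hone hle
  rw [Complex.one_re, mul_one] at h1
  have h2 := norm_integral_le_of_norm_le_const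
    (μ := Measure.pi fun _ : d => (AddCircle.haarAddCircle (T := 1))) (f := fun x => B x - p x)
    (Eventually.of_forall hd)
  rw [probReal_univ, mul_one, integral_sub (hi B) (hi p)] at h2
  have h4 := norm_sub_norm_le
    (∫ x, B x ∂(Measure.pi fun _ : d => (AddCircle.haarAddCircle (T := 1))))
    (∫ x, p x ∂(Measure.pi fun _ : d => (AddCircle.haarAddCircle (T := 1))))
  linarith

/-- **Kronecker's theorem**. -/
theorem exists_forall_dist_circleExp_lt [Fintype d] {ν : d → ℝ}
    (hind : ∀ n : d → ℤ, ∑ i, n i * ν i = 0 → n = 0) (θ : d → Circle) {ε : ℝ} (hε : 0 < ε) :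
    ∃ t : ℝ, ∀ i, dist (Circle.exp (ν i * t)) (θ i) < ε := by
  by_contra! hcon
  let y : UnitAddTorus d := fun i => (AddCircle.homeomorphCircle one_ne_zero).symm (θ i)
  have hy : ∀ i, AddCircle.toCircle (y i) = θ i := fun i => by
    rw [← AddCircle.homeomorphCircle_apply one_ne_zero, Homeomorph.apply_symm_apply]
  -- A bump supported near the target phases: it vanishes along a line that misses them, yet its
  -- integral is positive.
  let b : UnitAddTorus d → ℝ := fun x => ∏ i, max 0 (ε - dist (AddCircle.toCircle (x i)) (θ i))
  have hbc : Continuous b := by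
    refine continuous_finsetProd _ fun i _ => ?_
    have : Continuous fun x : UnitAddTorus d => AddCircle.toCircle (x i) :=
      AddCircle.continuous_toCircle.comp (continuous_apply i)
    fun_prop
  have hb0 : ∀ x, 0 ≤ b x := fun x => Finset.prod_nonneg fun i _ => le_max_left _ _
  have hby : b y ≠ 0 := by
    refine Finset.prod_ne_zero_iff.2 fun i _ => ?_
    rw [hy, dist_self, sub_zero, max_eq_right hε.le]
    exact hε.ne'
  have hbl : ∀ t, b (torusLine ν t) = 0 := fun t => by
    obtain ⟨i, hi⟩ := hcon t
    refine Finset.prod_eq_zero (Finset.mem_univ i) ?_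
    rw [toCircle_torusLine, max_eq_left (by linarith)]
  have hpos : 0 < ∫ x, b x ∂(Measure.pi fun _ : d => (AddCircle.haarAddCircle (T := 1))) :=
    hbc.integral_pos_of_hasCompactSupport_nonneg_nonzero (HasCompactSupport.of_compactSpace _)
      hb0 hby
  have h0 := integral_eq_zero_of_torusLine hind
    ⟨fun x => (b x : ℂ), Complex.continuous_ofReal.comp hbc⟩
    (fun t => by rw [ContinuousMap.coe_mk, hbl, Complex.ofReal_zero])
  simp only [ContinuousMap.coe_mk] at h0
  rw [integral_complex_ofReal, Complex.ofReal_eq_zero] at h0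
  exact hpos.ne' h0

end Kronecker

/-! ### Zeros from small values, and approximation of phases -/

/-- A holomorphic function that is smaller at the centre of a disc than on its boundary has a zero
in the disc. -/
theorem exists_zero_of_norm_lt {g : ℂ → ℂ} {z₀ : ℂ} {r m : ℝ} (hr : 0 < r)
    (hd : DiffContOnCl ℂ g (Metric.ball z₀ r)) (hs : ∀ z ∈ Metric.sphere z₀ r, m ≤ ‖g z‖)
    (h0 : ‖g z₀‖ < m) : ∃ z ∈ Metric.closedBall z₀ r, g z = 0 := by
  by_contra! hne
  have hm : 0 < m := (norm_nonneg _).trans_lt h0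
  have hcl : closure (Metric.ball z₀ r) = Metric.closedBall z₀ r := closure_ball z₀ hr.ne'
  -- Without a zero, the maximum principle for the reciprocal would bound `‖g z₀‖` below by `m`.
  have hinv : DiffContOnCl ℂ g⁻¹ (Metric.ball z₀ r) := hd.inv fun z hz => hne z (hcl ▸ hz)
  have h := Complex.norm_le_of_forall_mem_frontier_norm_le (C := m⁻¹) Metric.isBounded_ball hinv
    (fun z hz => ?_) (subset_closure (Metric.mem_ball_self hr))
  · rw [Pi.inv_apply, norm_inv,
      inv_le_inv₀ (norm_pos_iff.2 (hne z₀ (Metric.mem_closedBall_self hr.le))) hm] at h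
    exact absurd h (not_le.2 h0)
  · rw [frontier_ball z₀ hr.ne'] at hz
    rw [Pi.inv_apply, norm_inv]
    exact inv_anti₀ hm (hs z hz)

/-- Prescribed phases can be approximated along a line, with summable weights. -/
theorem exists_tsum_mul_dist_lt {ι : Type*} {ν : ι → ℝ} (hind : LinearIndependent ℤ ν)
    {u : ι → ℝ} (hu0 : ∀ i, 0 ≤ u i) (hu : Summable u) (θ : ι → Circle) {ε : ℝ} (hε : 0 < ε) :
    ∃ t : ℝ, ∑' i, u i * dist (Circle.exp (ν i * t)) (θ i) < ε := by
  have h2 : ∀ a b : Circle, dist a b ≤ 2 := fun a b => by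
    refine (dist_eq_norm (a : ℂ) b).trans_le ((norm_sub_le _ _).trans ?_)
    rw [Circle.norm_coe, Circle.norm_coe]; norm_num
  have htail : Tendsto (fun s : Finset ι => ∑' i, u i - ∑ i ∈ s, u i) atTop
      (𝓝 (∑' i, u i - ∑' i, u i)) := hu.hasSum.const_sub _
  rw [sub_self] at htail
  obtain ⟨s, hs⟩ := (htail.eventually_lt_const (show 0 < ε / 4 by positivity)).exists
  have hU : 0 ≤ ∑' i, u i := tsum_nonneg hu0
  -- Kronecker treats the finite set `s`; outside it the weights total less than `ε / 4` and
  -- distances are at most 2. The added 1 keeps the denominator positive.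
  obtain ⟨t, ht⟩ := exists_forall_dist_circleExp_lt (d := s) (ν := fun i => ν i)
    (fun n hn => eq_zero_of_sum_int_mul_eq_zero hind hn) (fun i => θ i)
    (ε := ε / (4 * (∑' i, u i + 1))) (by positivity)
  refine ⟨t, ?_⟩
  have hsum : Summable fun i => u i * dist (Circle.exp (ν i * t)) (θ i) :=
    Summable.of_nonneg_of_le (fun i => mul_nonneg (hu0 i) dist_nonneg)
      (fun i => mul_le_mul_of_nonneg_left (h2 _ _) (hu0 i)) (hu.mul_right 2)
  rw [← hsum.sum_add_tsum_subtype_compl s]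
  have e2 := hu.sum_add_tsum_subtype_compl s
  have hA : ∑ i ∈ s, u i * dist (Circle.exp (ν i * t)) (θ i) ≤ ε / 4 := by
    calc _ ≤ ∑ i ∈ s, u i * (ε / (4 * (∑' i, u i + 1))) :=
          Finset.sum_le_sum fun i hi => mul_le_mul_of_nonneg_left (ht ⟨i, hi⟩).le (hu0 i)
      _ = (∑ i ∈ s, u i) * (ε / (4 * (∑' i, u i + 1))) := by rw [Finset.sum_mul]
      _ ≤ (∑' i, u i + 1) * (ε / (4 * (∑' i, u i + 1))) :=
          mul_le_mul_of_nonneg_right (by linarith [hu.sum_le_tsum s fun i _ => hu0 i])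
            (by positivity)
      _ = ε / 4 := by field_simp
  have hB : ∑' i : {i // i ∉ s}, u i * dist (Circle.exp (ν i * t)) (θ i)
      ≤ ∑' i : {i // i ∉ s}, u i * 2 :=
    (hsum.subtype _).tsum_le_tsum (fun i => mul_le_mul_of_nonneg_left (h2 _ _) (hu0 i))
      ((hu.mul_right 2).subtype _)
  rw [tsum_mul_right] at hB
  linarith

/-! ### Almost periodic functions in a strip and their Dirichlet series -/

section Strip

variable {α β : EReal} {f : ℂ → ℂ}

theorem IsAlmostPeriodic.isBohr (hf : IsAlmostPeriodic α β f) {σ : ℝ} (h1 : α < σ)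
    (h2 : (σ : EReal) < β) : IsBohr fun t : ℝ => f (σ + t * Complex.I) := by
  have hre : ∀ t : ℝ, ((σ : ℂ) + t * Complex.I).re = σ := fun t => by simp
  refine ⟨hf.1.continuousOn.comp_continuous (by fun_prop) fun t => ?_, fun ε hε => ?_⟩
  · simp only [strip, Set.mem_ofPred_eq, hre]; exact ⟨h1, h2⟩
  · obtain ⟨l, hl, h⟩ := hf.2 σ σ h1 le_rfl h2 ε hε
    refine ⟨l, hl, fun t₀ => ?_⟩
    obtain ⟨τ, hτ, hs⟩ := h t₀
    refine ⟨τ, hτ, fun x => ?_⟩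
    have := hs (σ + x * Complex.I) (hre x).ge (hre x).le
    convert this using 4
    push_cast; ring

theorem IsAlmostPeriodic.exists_bound (hf : IsAlmostPeriodic α β f) {α₁ β₁ : ℝ} (h1 : α < α₁)
    (h12 : α₁ ≤ β₁) (h2 : (β₁ : EReal) < β) :
    ∃ C : ℝ, ∀ s : ℂ, α₁ ≤ s.re → s.re ≤ β₁ → ‖f s‖ ≤ C := by
  obtain ⟨l, hl, h⟩ := hf.2 α₁ β₁ h1 h12 h2 1 one_pos
  have hK : IsCompact (Set.Icc α₁ β₁ ×ℂ Set.Icc 0 l) := isCompact_Icc.reProdIm isCompact_Icc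
  obtain ⟨C, hC⟩ := hK.exists_bound_of_continuousOn (f := f) (hf.1.continuousOn.mono fun s hs =>
    ⟨h1.trans_le (EReal.coe_le_coe_iff.2 hs.1.1), (EReal.coe_le_coe_iff.2 hs.1.2).trans_lt h2⟩)
  refine ⟨C + 1, fun s hs1 hs2 => ?_⟩
  obtain ⟨τ, hτ, hs⟩ := h (-s.im)
  have h3 := hC (s + τ * Complex.I) (by
    rw [Complex.mem_reProdIm]
    simp only [Complex.add_re, Complex.add_im, Complex.mul_re, Complex.mul_im, Complex.ofReal_re,
      Complex.ofReal_im, Complex.I_re, Complex.I_im]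
    constructor
    · constructor <;> linarith
    · constructor <;> linarith [hτ.1, hτ.2])
  have h4 := norm_sub_norm_le (f s) (f (s + τ * Complex.I))
  rw [norm_sub_rev] at h4
  linarith [hs s hs1 hs2]

/-- The Fourier coefficients do not depend on the line on which they are computed. -/
theorem IsAlmostPeriodic.hasFourierCoeff (hf : IsAlmostPeriodic α β f) {c σ μ : ℝ} {a : ℂ}
    (hc1 : α < c) (hc2 : (c : EReal) < β) (hσ1 : α < σ) (hσ2 : (σ : EReal) < β)
    (h : HasFourierCoeff f c μ a) : HasFourierCoeff f σ μ a := by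
  have hlo : α < (min c σ : ℝ) := by
    rcases min_choice c σ with h | h <;> rw [h] <;> assumption
  have hhi : ((max c σ : ℝ) : EReal) < β := by
    rcases max_choice c σ with h | h <;> rw [h] <;> assumption
  obtain ⟨C, hC⟩ := hf.exists_bound hlo min_le_max hhi
  have hC0 : 0 ≤ C := (norm_nonneg _).trans (hC c (by simp) (by simp))
  set g : ℂ → ℂ := fun s => f s * Complex.exp (-(μ : ℂ) * s) with hg
  set M : ℝ := C * (Real.exp (-μ * min c σ) + Real.exp (-μ * max c σ)) with hM
  have hgM : ∀ s : ℂ, min c σ ≤ s.re → s.re ≤ max c σ → ‖g s‖ ≤ M := fun s h1 h2 => by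
    rw [hg, hM, norm_mul, Complex.norm_exp]
    refine mul_le_mul (hC s h1 h2) ?_ (Real.exp_pos _).le hC0
    have : (-(μ : ℂ) * s).re = -μ * s.re := by simp
    rw [this]
    rcases le_total 0 (-μ) with hμ | hμ
    · exact (Real.exp_le_exp.2 (mul_le_mul_of_nonneg_left h2 hμ)).trans
        (le_add_of_nonneg_left (Real.exp_pos _).le)
    · exact (Real.exp_le_exp.2 (mul_le_mul_of_nonpos_left h1 hμ)).trans
        (le_add_of_nonneg_right (Real.exp_pos _).le)
  have hgd : DifferentiableOn ℂ g (strip α β) := hf.1.mul (by fun_prop)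
  have hsub : ∀ s : ℂ, min c σ ≤ s.re → s.re ≤ max c σ → s ∈ strip α β := fun s h1 h2 =>
    ⟨hlo.trans_le (EReal.coe_le_coe_iff.2 h1), (EReal.coe_le_coe_iff.2 h2).trans_lt hhi⟩
  have hrect : ∀ T : ℝ, ‖(∫ y in (-T)..T, g (σ + y * Complex.I))
      - ∫ y in (-T)..T, g (c + y * Complex.I)‖ ≤ 2 * (M * |σ - c|) := fun T => by
    -- Cauchy's theorem on the rectangle between the two lines: the horizontal sides stay bounded as
    -- `T` grows, and division by `2 * T` removes them.
    have hcau := Complex.integral_boundary_rect_eq_zero_of_differentiableOn g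
      ⟨c, -T⟩ ⟨σ, T⟩ (hgd.mono fun s hs => hsub s hs.1.1 hs.1.2)
    simp only [smul_eq_mul] at hcau
    have hb : ∀ y : ℝ, ‖∫ x in c..σ, g (x + y * Complex.I)‖ ≤ M * |σ - c| := fun y =>
      intervalIntegral.norm_integral_le_of_norm_le_const fun x hx => by
        have hx' := Set.uIoc_subset_uIcc hx
        exact hgM _ (by simpa using hx'.1) (by simpa using hx'.2)
    have e : (∫ y in (-T)..T, g (σ + y * Complex.I)) - ∫ y in (-T)..T, g (c + y * Complex.I)
        = Complex.I * ((∫ x in c..σ, g (x + (-T : ℝ) * Complex.I))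
          - ∫ x in c..σ, g (x + T * Complex.I)) := by
      linear_combination (-Complex.I) * hcau + ((∫ y in (-T)..T, g (σ + y * Complex.I))
        - ∫ y in (-T)..T, g (c + y * Complex.I)) * Complex.I_mul_I
    rw [e, norm_mul, Complex.norm_I, one_mul]
    exact (norm_sub_le _ _).trans (by linarith [hb (-T), hb T])
  have hdiff : Tendsto (fun T : ℝ => (2 * (T : ℂ))⁻¹ * ((∫ y in (-T)..T, g (σ + y * Complex.I))
      - ∫ y in (-T)..T, g (c + y * Complex.I))) atTop (𝓝 0) := by
    have h0 : Tendsto (fun T : ℝ => ‖(2 * T)⁻¹‖ * (2 * (M * |σ - c|))) atTop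
        (𝓝 (0 * (2 * (M * |σ - c|)))) := by
      refine Tendsto.mul_const _ ?_
      rw [← tendsto_zero_iff_norm_tendsto_zero]
      exact (tendsto_id.const_mul_atTop zero_lt_two).inv_tendsto_atTop
    rw [zero_mul] at h0
    refine squeeze_zero_norm (fun T => ?_) h0
    have e : (2 * (T : ℂ))⁻¹ = ((2 * T)⁻¹ : ℝ) := by push_cast; rfl
    rw [norm_mul, e, Complex.norm_real]
    exact mul_le_mul_of_nonneg_left (hrect T) (norm_nonneg _)
  have := Filter.Tendsto.add h hdiff
  rw [add_zero] at this
  refine this.congr fun T => ?_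
  simp only [hg]
  ring

theorem HasFourierCoeff.hasMean {σ μ : ℝ} {a : ℂ} (h : HasFourierCoeff f σ μ a) :
    HasMean (fun t : ℝ => f (σ + t * Complex.I) * chr μ t) (a * Complex.exp (μ * σ)) := by
  have := Filter.Tendsto.mul_const (Complex.exp (μ * σ)) h
  refine this.congr fun T => ?_
  rw [mul_assoc, ← intervalIntegral.integral_mul_const]
  congr 1
  refine intervalIntegral.integral_congr fun t _ => ?_
  simp only [chr]
  rw [mul_assoc, ← Complex.exp_add]
  ring_nf

/-- In the whole strip, an almost periodic function with linearly independent exponents is the sum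
of its absolutely convergent Dirichlet series. -/
theorem IsAlmostPeriodic.hasSum_dirichletSeries {ι : Type*} {a : ι → ℂ} {ν : ι → ℝ}
    (hf : IsAlmostPeriodic α β f) (hseries : IsDirichletSeries α β f a ν)
    (hind : LinearIndependent ℚ ν) {σ : ℝ} (h1 : α < σ) (h2 : (σ : EReal) < β) :
    Summable (fun i => ‖a i‖ * Real.exp (σ * ν i)) ∧
      ∀ t : ℝ, HasSum (fun i => a i * Complex.exp (ν i * (σ + t * Complex.I)))
        (f (σ + t * Complex.I)) := by
  obtain ⟨-, ha, c, hc1, hc2, hA, h0⟩ := hseries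
  have key := (hf.isBohr h1 h2).hasSum_fourier (A := fun i => a i * Complex.exp (ν i * σ))
    (ν := ν) (fun i => mul_ne_zero (ha i) (Complex.exp_ne_zero _)) hind
    (fun i => (hf.hasFourierCoeff hc1 hc2 h1 h2 (hA i)).hasMean)
    (fun μ hμ => by simpa using (hf.hasFourierCoeff hc1 hc2 h1 h2 (h0 μ hμ)).hasMean)
  refine ⟨key.1.congr fun i => ?_, fun t => (key.2 t).congr_fun fun i => ?_⟩
  · rw [norm_mul, ← Complex.ofReal_mul, Complex.norm_exp_ofReal, mul_comm σ]
  · rw [mul_assoc, ← Complex.exp_add]; congr 2; ring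

theorem exists_closed_substrip {σ₀ : ℝ} (h1 : α < σ₀) (h2 : (σ₀ : EReal) < β) :
    ∃ δ : ℝ, 0 < δ ∧ α < (σ₀ - δ : ℝ) ∧ ((σ₀ + δ : ℝ) : EReal) < β := by
  have hlo : ∀ᶠ δ : ℝ in 𝓝[>] 0, α < (σ₀ - δ : ℝ) := by
    have : Tendsto (fun δ : ℝ => ((σ₀ - δ : ℝ) : EReal)) (𝓝[>] 0) (𝓝 ((σ₀ - 0 : ℝ) : EReal)) :=
      ((continuous_coe_real_ereal.comp (continuous_const.sub continuous_id)).tendsto 0).mono_left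
        nhdsWithin_le_nhds
    rw [sub_zero] at this
    exact this.eventually_const_lt h1
  have hhi : ∀ᶠ δ : ℝ in 𝓝[>] 0, ((σ₀ + δ : ℝ) : EReal) < β := by
    have : Tendsto (fun δ : ℝ => ((σ₀ + δ : ℝ) : EReal)) (𝓝[>] 0) (𝓝 ((σ₀ + 0 : ℝ) : EReal)) :=
      ((continuous_coe_real_ereal.comp (continuous_const.add continuous_id)).tendsto 0).mono_left
        nhdsWithin_le_nhds
    rw [add_zero] at this
    exact this.eventually_lt_const h2
  obtain ⟨δ, ⟨h3, h4⟩, h5⟩ := ((hlo.and hhi).and self_mem_nhdsWithin).exists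
  exact ⟨δ, h5, h3, h4⟩

/-- It turns summability on the two edges of a substrip into a single majorant for the whole
substrip, whatever the signs of the exponents. -/
theorem exp_mul_le_add {x y σ ν : ℝ} (h1 : x ≤ σ) (h2 : σ ≤ y) :
    Real.exp (σ * ν) ≤ Real.exp (x * ν) + Real.exp (y * ν) := by
  rcases le_total 0 ν with h | h
  · exact (Real.exp_le_exp.2 (mul_le_mul_of_nonneg_right h2 h)).trans
      (le_add_of_nonneg_left (Real.exp_pos _).le)
  · exact (Real.exp_le_exp.2 (mul_le_mul_of_nonpos_right h1 h)).trans
      (le_add_of_nonneg_right (Real.exp_pos _).le)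

theorem norm_mul_exp {a : ℂ} {ν : ℝ} (s : ℂ) :
    ‖a * Complex.exp (ν * s)‖ = ‖a‖ * Real.exp (s.re * ν) := by
  rw [norm_mul, Complex.norm_exp, Complex.re_ofReal_mul, mul_comm ν]

end Strip

/-! ### Real parts of zeros near a given line -/

section Zeros

variable {ι : Type*} {α β : EReal} {f : ℂ → ℂ} {a : ι → ℂ} {ν : ι → ℝ}

theorem mem_strip_add {α β : EReal} {s : ℂ} (hs : s ∈ strip α β) (t : ℝ) :
    s + t * Complex.I ∈ strip α β := by
  simpa [strip] using hs

/-- If one term dominates, a vertical line carries no limit of real parts of zeros. -/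
theorem le_tsum_of_mem_zeroProjections {σ₀ : ℝ}
    (hsum : ∀ σ : ℝ, α < σ → (σ : EReal) < β → Summable (fun i => ‖a i‖ * Real.exp (σ * ν i)) ∧
      ∀ t : ℝ, HasSum (fun i => a i * Complex.exp (ν i * (σ + t * Complex.I)))
        (f (σ + t * Complex.I)))
    (hα : α < σ₀) (hβ : (σ₀ : EReal) < β) (hmem : σ₀ ∈ zeroProjections α β f) (j : ι) :
    ‖a j‖ * Real.exp (σ₀ * ν j) ≤ ∑' i : {i : ι // i ≠ j}, ‖a i‖ * Real.exp (σ₀ * ν i) := by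
  obtain ⟨δ, hδ, h1, h2⟩ := exists_closed_substrip hα hβ
  by_contra! hlt
  -- Continuity of both sides carries the strict inequality to a neighbourhood of `σ₀`, which
  -- contains the real part of an actual zero.
  have hcont : ContinuousOn
      (fun σ : ℝ => ∑' i : {i : ι // i ≠ j}, ‖a i‖ * Real.exp (σ * ν i))
      (Set.Icc (σ₀ - δ) (σ₀ + δ)) := by
    have hs1 := (hsum _ h1 ((EReal.coe_le_coe_iff.2 (by linarith)).trans_lt h2)).1
    have hs2 := (hsum _ (h1.trans_le (EReal.coe_le_coe_iff.2 (by linarith))) h2).1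
    refine continuousOn_tsum (fun i => by fun_prop) ((hs1.add hs2).subtype {i | i ≠ j})
      fun i σ hσ => ?_
    rw [Real.norm_of_nonneg (by positivity)]
    simp only [Function.comp]
    rw [← mul_add]
    exact mul_le_mul_of_nonneg_left (exp_mul_le_add hσ.1 hσ.2) (norm_nonneg _)
  have hca := hcont.continuousAt (Icc_mem_nhds (sub_lt_self σ₀ hδ) (lt_add_of_pos_right σ₀ hδ))
  have hcj : ContinuousAt (fun σ : ℝ => ‖a j‖ * Real.exp (σ * ν j)) σ₀ := by fun_prop
  obtain ⟨_, hev, ⟨s, ⟨hs, hs0⟩, rfl⟩⟩ :=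
    mem_closure_iff_nhds.1 hmem.1 _ (hca.eventually_lt hcj hlt)
  obtain ⟨hsm, hH⟩ := hsum s.re hs.1 hs.2
  have hH := hH s.im
  rw [Complex.re_add_im, hs0] at hH
  simp only [Set.mem_ofPred_eq] at hev
  have hsplit := tsum_eq_add_tsum_ne hH.summable j
  rw [hH.tsum_eq] at hsplit
  have hn : ‖∑' i : {i : ι // i ≠ j}, a i * Complex.exp (ν i * s)‖
      ≤ ∑' i : {i : ι // i ≠ j}, ‖a i‖ * Real.exp (s.re * ν i) :=
    tsum_of_norm_bounded (hsm.subtype {i | i ≠ j}).hasSum fun i => (norm_mul_exp s).le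
  have hj : ‖a j * Complex.exp (ν j * s)‖ = ‖∑' i : {i : ι // i ≠ j}, a i * Complex.exp (ν i * s)‖ := by
    rw [eq_neg_of_add_eq_zero_left hsplit.symm, norm_neg]
  rw [norm_mul_exp] at hj
  linarith

/-- A zero on a line of the Dirichlet series with changed phases gives zeros of the original
function near that line. -/
theorem mem_zeroProjections_of_phases [Nonempty ι] (hfd : DifferentiableOn ℂ f (strip α β))
    (ha : ∀ i, a i ≠ 0) (hind : LinearIndependent ℚ ν) {σ₀ : ℝ}
    (hsum : ∀ σ : ℝ, α < σ → (σ : EReal) < β → Summable (fun i => ‖a i‖ * Real.exp (σ * ν i)) ∧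
      ∀ t : ℝ, HasSum (fun i => a i * Complex.exp (ν i * (σ + t * Complex.I)))
        (f (σ + t * Complex.I)))
    (hα : α < σ₀) (hβ : (σ₀ : EReal) < β) (θ : ι → Circle)
    (hθ : ∑' i, a i * θ i * Complex.exp (ν i * σ₀) = 0) : σ₀ ∈ zeroProjections α β f := by
  classical
  obtain ⟨δ, hδ, h1, h2⟩ := exists_closed_substrip hα hβ
  set u : ι → ℝ := fun i =>
    ‖a i‖ * Real.exp ((σ₀ - δ) * ν i) + ‖a i‖ * Real.exp ((σ₀ + δ) * ν i) with hu
  have hus : Summable u :=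
    (hsum _ h1 ((EReal.coe_le_coe_iff.2 (by linarith)).trans_lt h2)).1.add
      (hsum _ (h1.trans_le (EReal.coe_le_coe_iff.2 (by linarith))) h2).1
  have hu0 : ∀ i, 0 ≤ u i := fun i => by positivity
  set V : Set ℂ := Complex.re ⁻¹' Set.Ioo (σ₀ - δ) (σ₀ + δ) with hV
  have hVo : IsOpen V := isOpen_Ioo.preimage Complex.continuous_re
  have hVs : V ⊆ strip α β := fun s hs =>
    ⟨h1.trans (EReal.coe_lt_coe_iff.2 hs.1), (EReal.coe_lt_coe_iff.2 hs.2).trans h2⟩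
  have hVc : IsPreconnected V :=
    ((convex_Ioo (σ₀ - δ) (σ₀ + δ)).linear_preimage Complex.reLm).isPreconnected
  have hσV : (σ₀ : ℂ) ∈ V := by simp [hV, hδ]
  have hbd : ∀ i (c : ℂ) (s : ℂ), s ∈ V →
      ‖a i * c * Complex.exp (ν i * s)‖ ≤ u i * ‖c‖ := fun i c s hs => by
    rw [mul_right_comm, norm_mul, norm_mul_exp]
    refine mul_le_mul_of_nonneg_right ?_ (norm_nonneg _)
    simp only [hu]
    rw [← mul_add]
    exact mul_le_mul_of_nonneg_left (exp_mul_le_add hs.1.le hs.2.le) (norm_nonneg _)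
  set G : ℂ → ℂ := fun s => ∑' i, a i * θ i * Complex.exp (ν i * s) with hG
  have hGs : ∀ s ∈ V, Summable fun i => a i * θ i * Complex.exp (ν i * s) := fun s hs =>
    Summable.of_norm_bounded hus fun i => (hbd i _ s hs).trans_eq (by rw [Circle.norm_coe, mul_one])
  have hGd : DifferentiableOn ℂ G V :=
    Complex.differentiableOn_tsum_of_summable_norm hus (fun i => by fun_prop) hVo
      fun i s hs => (hbd i _ s hs).trans_eq (by rw [Circle.norm_coe, mul_one])
  have hGa : AnalyticOnNhd ℂ G V := hGd.analyticOnNhd hVo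
  have hline : ∀ t : ℝ, (σ₀ : ℂ) + t * Complex.I ∈ V := fun t => by simp [hV, hδ]
  -- If `G` vanished near `σ₀`, it would vanish on the whole line, and so would its Fourier
  -- coefficient at `ν j`, a nonzero multiple of `a j`.
  have hne : ∀ᶠ z in 𝓝[≠] (σ₀ : ℂ), G z ≠ 0 := by
    refine (hGa _ hσV).eventually_eq_zero_or_eventually_ne_zero.resolve_left fun hz => ?_
    have hzero := hGa.eqOn_zero_of_preconnected_of_eventuallyEq_zero hVc hσV hz
    obtain ⟨j⟩ := ‹Nonempty ι›
    obtain ⟨hs0, -⟩ := hsum σ₀ hα hβ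
    have : Countable ι := countable_of_summable hs0 fun i =>
      mul_ne_zero (norm_ne_zero_iff.2 (ha i)) (Real.exp_ne_zero _)
    have hmean := hasMean_tsum_mul_chr (A := fun i => a i * θ i * Complex.exp (ν i * σ₀)) (ν := ν)
      (hs0.congr fun i => by
        rw [mul_right_comm, norm_mul, norm_mul_exp, Circle.norm_coe, mul_one, Complex.ofReal_re])
      (ν j)
    have e : ∀ t : ℝ, ∑' i, a i * θ i * Complex.exp (ν i * σ₀) *
        Complex.exp (ν i * t * Complex.I) = 0 := fun t => by
      have := hzero (hline t)
      simp only [hG, Pi.zero_apply] at this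
      rw [← this]
      refine tsum_congr fun i => ?_
      rw [mul_assoc, ← Complex.exp_add]
      ring_nf
    simp_rw [e] at hmean
    have hmean0 : HasMean (fun x => 0 * chr (ν j) x) 0 := by simp [HasMean]
    have hval := tendsto_nhds_unique hmean hmean0
    rw [tsum_eq_single j fun b hb => by
      rw [if_neg fun h => hb (hind.injective h.symm), mul_zero]] at hval
    simp [ha j, Complex.exp_ne_zero] at hval
  refine ⟨Metric.mem_closure_iff.2 fun η hη => ?_, hα, hβ⟩
  obtain ⟨ρ, hρ, hball⟩ := Metric.mem_nhdsWithin_iff.1 hne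
  -- Here `ρ` isolates the zero of `G`, `η` is the required accuracy and `δ` keeps the disc inside
  -- `V`.
  set r : ℝ := min (min ρ η) δ / 2 with hr
  have hmin : 0 < min (min ρ η) δ := lt_min (lt_min hρ hη) hδ
  have hr0 : 0 < r := half_pos hmin
  have hrρ : r < ρ := (half_lt_self hmin).trans_le ((min_le_left _ _).trans (min_le_left _ _))
  have hrη : r < η := (half_lt_self hmin).trans_le ((min_le_left _ _).trans (min_le_right _ _))
  have hrδ : r < δ := (half_lt_self hmin).trans_le (min_le_right _ _)
  have hcV : Metric.closedBall (σ₀ : ℂ) r ⊆ V := fun z hz => by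
    have := (Complex.abs_re_le_norm (z - σ₀)).trans (mem_closedBall_iff_norm.1 hz)
    rw [Complex.sub_re, Complex.ofReal_re, abs_le] at this
    exact ⟨by linarith [this.1], by linarith [this.2]⟩
  obtain ⟨m, hm, hGm⟩ : ∃ m : ℝ, 0 < m ∧ ∀ z ∈ Metric.sphere (σ₀ : ℂ) r, m ≤ ‖G z‖ := by
    have hnes : (Metric.sphere (σ₀ : ℂ) r).Nonempty := NormedSpace.sphere_nonempty.2 hr0.le
    obtain ⟨z, hz, hmin⟩ := (isCompact_sphere (σ₀ : ℂ) r).exists_isMinOn hnes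
      ((hGd.continuousOn.mono (Metric.sphere_subset_closedBall.trans hcV)).norm)
    refine ⟨‖G z‖, norm_pos_iff.2 (hball ⟨?_, ?_⟩), fun w hw => hmin hw⟩
    · rw [Metric.mem_ball, Metric.mem_sphere.1 hz]; exact hrρ
    · rintro rfl
      simp [hr0.ne] at hz
  -- The weights `u` majorise the terms on all of `V`, so one `t` makes the translate of `f`
  -- uniformly `m / 2`-close to `G`. It is then below `m / 2` at the centre and at least `m / 2` on
  -- the circle.
  obtain ⟨t, ht⟩ := exists_tsum_mul_dist_lt (linearIndependent_int hind) hu0 hus θ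
    (show 0 < m / 2 by positivity)
  have hclose : ∀ z ∈ V, ‖f (z + t * Complex.I) - G z‖ < m / 2 := fun z hz => by
    refine lt_of_le_of_lt ?_ ht
    have hH := (hsum z.re (hVs hz).1 (hVs hz).2).2 (z.im + t)
    have e1 : (z.re : ℂ) + ((z.im + t : ℝ) : ℂ) * Complex.I = z + t * Complex.I := by
      conv_rhs => rw [← Complex.re_add_im z]
      push_cast; ring
    rw [e1] at hH
    have hD := hH.sub (hGs z hz).hasSum
    rw [← hD.tsum_eq]
    have hdist : ∀ i, u i * dist (Circle.exp (ν i * t)) (θ i) ≤ u i * 2 := fun i => by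
      refine mul_le_mul_of_nonneg_left ?_ (hu0 i)
      refine (dist_eq_norm (Circle.exp (ν i * t) : ℂ) (θ i)).trans_le ((norm_sub_le _ _).trans ?_)
      rw [Circle.norm_coe, Circle.norm_coe]; norm_num
    have hds : Summable fun i => u i * dist (Circle.exp (ν i * t)) (θ i) :=
      Summable.of_nonneg_of_le (fun i => mul_nonneg (hu0 i) dist_nonneg) hdist (hus.mul_right 2)
    refine tsum_of_norm_bounded hds.hasSum fun i => ?_
    have e2 : a i * Complex.exp (ν i * (z + t * Complex.I)) - a i * θ i * Complex.exp (ν i * z)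
        = a i * ((Circle.exp (ν i * t) : ℂ) - θ i) * Complex.exp (ν i * z) := by
      rw [Circle.coe_exp, mul_add, Complex.exp_add]
      push_cast
      ring_nf
    rw [e2]
    exact (hbd i _ z hz).trans_eq (by rw [← dist_eq_norm]; rfl)
  have hgd : DifferentiableOn ℂ (fun z => f (z + t * Complex.I)) V :=
    hfd.comp (by fun_prop) fun z hz => mem_strip_add (hVs hz) t
  have hsphere : ∀ z ∈ Metric.sphere (σ₀ : ℂ) r, m / 2 ≤ ‖f (z + t * Complex.I)‖ := fun z hz => by
    have h3 := hclose z (hcV (Metric.sphere_subset_closedBall hz))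
    have h4 := norm_sub_norm_le (G z) (f (z + t * Complex.I))
    rw [norm_sub_rev] at h4
    linarith [hGm z hz]
  have hcentre : ‖f (σ₀ + t * Complex.I)‖ < m / 2 := by
    have h3 := hclose σ₀ hσV
    have e : G σ₀ = 0 := hθ
    rwa [e, sub_zero] at h3
  obtain ⟨z, hz, hz0⟩ := exists_zero_of_norm_lt hr0 (hgd.diffContOnCl_ball hcV) hsphere hcentre
  refine ⟨(z + t * Complex.I).re, ⟨_, ⟨mem_strip_add (hVs (hcV hz)) t, hz0⟩, rfl⟩, ?_⟩
  have := (Complex.abs_re_le_norm (z - σ₀)).trans (mem_closedBall_iff_norm.1 hz)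
  rw [dist_comm, Real.dist_eq]
  simp only [Complex.sub_re, Complex.ofReal_re] at this
  simpa using this.trans_lt hrη

end Zeros

end AlmostPeriodicStrip

/-! ### The criterion -/

theorem mainTheorem2 {ι : Type*} (α β : EReal) (f : ℂ → ℂ) (a : ι → ℂ) (ν : ι → ℝ)
    (hf : AlmostPeriodicStrip.IsAlmostPeriodic α β f)
    (hseries : AlmostPeriodicStrip.IsDirichletSeries α β f a ν)
    (hindep : LinearIndependent ℚ ν)
    (hthree : 3 ≤ ENat.card ι)
    (σ₀ : ℝ) (hα : α < (σ₀ : EReal)) (hβ : (σ₀ : EReal) < β) :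
    Summable (fun i : ι => ‖a i‖ * Real.exp (σ₀ * ν i)) ∧
      (σ₀ ∈ AlmostPeriodicStrip.zeroProjections α β f ↔
        ∀ j : ι, ‖a j‖ * Real.exp (σ₀ * ν j) ≤
          ∑' i : {i : ι // i ≠ j}, ‖a i‖ * Real.exp (σ₀ * ν i)) := by
  have hsum : ∀ σ : ℝ, α < σ → (σ : EReal) < β → _ := fun σ h1 h2 =>
    hf.hasSum_dirichletSeries hseries hindep h1 h2
  have hs := (hsum σ₀ hα hβ).1
  -- Some exponent is needed for the rephased series not to vanish identically.
  have hne : Nonempty ι := by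
    by_contra h
    rw [not_nonempty_iff] at h
    rw [ENat.card_eq_zero_iff_empty ι |>.2 h] at hthree
    exact absurd hthree (by decide)
  have ha := hseries.2.1
  refine ⟨hs, fun hmem => AlmostPeriodicStrip.le_tsum_of_mem_zeroProjections hsum hα hβ hmem,
    fun h => ?_⟩
  obtain ⟨θ, hθ⟩ := AlmostPeriodicStrip.exists_circle_tsum_eq_zero
    (fun i => mul_pos (norm_pos_iff.2 (ha i)) (Real.exp_pos _)) hs h
  -- The polygon is built from the moduli; `w i` also cancels the argument of `a i`.
  choose w hw using fun i => show ∃ w : Circle, a i * w = ‖a i‖ * (θ i : ℂ) by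
    have hn : (‖a i‖ : ℂ) ≠ 0 := by exact_mod_cast norm_ne_zero_iff.2 (ha i)
    have h1 : ‖(‖a i‖ : ℂ) * (θ i : ℂ) / a i‖ = 1 := by
      rw [norm_div, norm_mul, Circle.norm_coe, mul_one, Complex.norm_real, norm_norm,
        div_self (norm_ne_zero_iff.2 (ha i))]
    exact ⟨⟨_, mem_sphere_zero_iff_norm.2 h1⟩, mul_div_cancel₀ _ (ha i)⟩
  refine AlmostPeriodicStrip.mem_zeroProjections_of_phases hf.1 ha hindep hsum hα hβ w ?_
  rw [← hθ]
  refine tsum_congr fun i => ?_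
  rw [hw]
  push_cast
  ring_nf
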